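/- Let $X\subset\mathbb P^m$ be a smooth irreducible complex projective variety of dimension $n\le m-2$ that lies in no hyperplane and whose dual variety $X^*\subset\mathbb P^{m*}$ (the closure of the set of hyperplanes containing a tangent space of $X$) is a hypersurface; let $c=\deg X^*$ be the class of $X$. Let $\pi_1,\pi_2:\mathbb P^m\dashrightarrow\mathbb P^{m-1}$ be two projections, given by $m\times(m+1)$ matrices $\mathbf M_1,\mathbf M_2$ of rank $m$, with distinct centers lying outside $X$, such that the dual varieties $Y_1^*,Y_2^*\subset\mathbb P^{(m-1)*}$ of $Y_i=\pi_i(X)$ (closures of the sets of hyperplanes containing a tangent space of $Y_i$ at a smooth point) are hypersurfaces, with reduced equations $\varphi_1,\varphi_2$. (This holds for generic centers.) Identify $\wedge^{m-1}\mathbb C^m$ with $(\mathbb C^m)^*$. The fundamental matrix of order $2$ of a pair of projections with distinct centers is the $m\times\binom m2$ matrix $\mathbf F$, defined up to a nonzero scalar, of the linear map $\wedge^{m-2}\mathbb C^m\to\wedge^{m-1}\mathbb C^m$ that sends the extensor of an $(m-3)$-plane $W$ to an extensor of $\pi_2(\pi_1^{-1}(W))$ (to $0$ if $W$ contains the first epipole).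 Let $N$ be the dimension of the space of all fundamental matrices of order $2$ (of all pairs of projections $\mathbb P^m\dashrightarrow\mathbb P^{m-1}$ with distinct centers), modulo scalars. Let $V\subset\mathbb P^{m-1}\times\mathbb P\big(\mathbb C^{m\times\binom m2}\big)\times\mathbb P^{m-1}$ be the solution variety, i.e. the set of triples $(\mathbf e_1,\mathbf F,\mathbf e_2)$ such that $$\mathbf F(\mathbf e_1\wedge\mathbf u)=0\ \text{ for all }\mathbf u\in\wedge^{m-3}\mathbb C^m,\qquad \mathbf F^T\mathbf e_2=0,$$ and the generalized Kruppa equation holds: there is a scalar $\lambda\neq0$ with $$\varphi_2(\mathbf F\mathbf w)=\lambda\,\varphi_1(\mathbf e_1\wedge\mathbf w)\quad\text{for all extensors }\mathbf w\in\wedge^{m-2}\mathbb C^m .$$ If $V$ is non-empty, then (writing $\dim V$ for the dimension of its Zariski closure) $$\dim V\ \ge\ N-\binom{m-2+c}{c}+1 .$$ In particular, if $V$ is non-empty and finite, then $N+1\le\binom{m-2+c}{c}$. -/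

import Mathlib

noncomputable section

namespace GenKruppa

/-! ### Subsets of projective spaces over the complex numbers

A projective space is written `PSpace ι`: the lines of `ι → ℂ`, so that `PSpace (Fin (r + 1))`
is the `r`-dimensional projective space. A point of the dual space of `PSpace ι` (a hyperplane)
is given by its coefficients, hence is again a point of `PSpace ι`. -/

/-- The projective space of lines in `ι → ℂ`. -/
abbrev PSpace (ι : Type) : Type := Projectivization ℂ (ι → ℂ)

section Single

variable {ι : Type}

/-- The punctured affine cone over a set of points of a projective space. -/
def cone (Z : Set (PSpace ι)) : Set (ι → ℂ) :=
  {v | ∃ hv : v ≠ 0, Projectivization.mk ℂ v hv ∈ Z}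

/-- The ideal of all polynomials that vanish on the cone over `Z`; it is the homogeneous ideal
of `Z` when `Z` is not empty. -/
def ideal (Z : Set (PSpace ι)) : Ideal (MvPolynomial ι ℂ) :=
  MvPolynomial.vanishingIdeal ℂ (cone Z)

/-- The Zariski closure of a set of points of a projective space. -/
def zariskiClosure (Z : Set (PSpace ι)) : Set (PSpace ι) :=
  {p | ∀ f ∈ ideal Z, MvPolynomial.eval p.rep f = 0}

variable [Fintype ι]

/-- The dimension of (the Zariski closure of) a non-empty subset of an affine space: the Krull
dimension of its ring of polynomial functions. That ring is a nonzero finitely generated algebra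
over a field, so its Krull dimension is a natural number. -/
def affineDim (A : Set (ι → ℂ)) : ℤ :=
  (((ringKrullDim (MvPolynomial ι ℂ ⧸ MvPolynomial.vanishingIdeal ℂ A)).unbotD 0).toNat : ℤ)

/-- The dimension of a non-empty subset of a projective space: one less than that of its cone. -/
def projDim (Z : Set (PSpace ι)) : ℤ := affineDim (cone Z) - 1

/-- The embedded tangent space to `Z` at a point, as a linear subspace of `ι → ℂ`: the common
kernel of the differentials at `v` of the polynomials that vanish on `Z`. -/
def tangentSpace (Z : Set (PSpace ι)) (v : ι → ℂ) : Submodule ℂ (ι → ℂ) where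
  carrier := {u | ∀ f ∈ ideal Z, ∑ i, MvPolynomial.eval v (MvPolynomial.pderiv i f) * u i = 0}
  zero_mem' := by intro f _; simp
  add_mem' := by
    intro a b ha hb f hf
    simp only [Pi.add_apply, mul_add, Finset.sum_add_distrib]
    rw [ha f hf, hb f hf, add_zero]
  smul_mem' := by
    intro t a ha f hf
    have h : ∑ i, MvPolynomial.eval v (MvPolynomial.pderiv i f) * (t • a) i
        = t * ∑ i, MvPolynomial.eval v (MvPolynomial.pderiv i f) * a i := by
      rw [Finset.mul_sum]
      refine Finset.sum_congr rfl fun i _ => ?_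
      simp only [Pi.smul_apply, smul_eq_mul]
      ring
    rw [h, ha f hf, mul_zero]

/-- `Z` is smooth at the point with homogeneous coordinates `v` (Jacobian criterion, for an
irreducible `Z`). -/
def IsSmoothAt (Z : Set (PSpace ι)) (v : ι → ℂ) : Prop :=
  (Module.finrank ℂ (tangentSpace Z v) : ℤ) = projDim Z + 1

/-- `X` is a smooth irreducible (closed) projective variety of dimension `n`. -/
structure IsSmoothVariety (X : Set (PSpace ι)) (n : ℕ) : Prop where
  closed : zariskiClosure X = X
  irreducible : (ideal X).IsPrime
  dim_eq : projDim X = n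
  smooth : ∀ v ∈ cone X, IsSmoothAt X v

/-- `X` is contained in no hyperplane. -/
def Nondegenerate (X : Set (PSpace ι)) : Prop :=
  ∀ h : ι → ℂ, (∀ v ∈ cone X, h ⬝ᵥ v = 0) → h = 0

/-- The dual variety of `Z`: the Zariski closure of the set of the hyperplanes that contain the
tangent space to `Z` at some smooth point. -/
def dualVariety (Z : Set (PSpace ι)) : Set (PSpace ι) :=
  zariskiClosure {h | ∃ v ∈ cone Z, IsSmoothAt Z v ∧ ∀ u ∈ tangentSpace Z v, h.rep ⬝ᵥ u = 0}

/-- `Z` is a hypersurface, and `φ` is its polynomial: the generator, unique up to a nonzero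
constant, of the ideal of `Z`. The degree of `Z` is the degree of `φ`. -/
def IsHypersurfaceWith (Z : Set (PSpace ι)) (φ : MvPolynomial ι ℂ) : Prop :=
  φ ≠ 0 ∧ ¬ IsUnit φ ∧ ideal Z = Ideal.span {φ}

end Single

section Triple

variable {ι κ τ : Type}

/-- The set of the triples of nonzero vectors that represent the points of a subset of a product
of three projective spaces. -/
def cone₃ (V : Set (PSpace ι × PSpace κ × PSpace τ)) : Set (ι ⊕ κ ⊕ τ → ℂ) :=
  {x | ∃ (h₁ : (fun i => x (Sum.inl i)) ≠ 0) (h₂ : (fun i => x (Sum.inr (Sum.inl i))) ≠ 0)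
      (h₃ : (fun i => x (Sum.inr (Sum.inr i))) ≠ 0),
    (Projectivization.mk ℂ _ h₁, Projectivization.mk ℂ _ h₂, Projectivization.mk ℂ _ h₃) ∈ V}

/-- The dimension of a non-empty subset of a product of three projective spaces: three less than
that of its multi-cone. -/
def projDim₃ [Fintype ι] [Fintype κ] [Fintype τ] (V : Set (PSpace ι × PSpace κ × PSpace τ)) : ℤ :=
  affineDim (cone₃ V) - 3

end Triple

/-! ### Projections, fundamental matrices and the solution variety

Throughout `m = k + 2`, so that the `(m - 3)`-planes of the `(m - 1)`-dimensional projective space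
are the linear subspaces of dimension `k` in `Fin (k + 2) → ℂ`. -/

variable {k : ℕ}

/-- The image of `X` in the projective space of dimension `m - 1` under the projection with
matrix `M`. -/
def projection (M : Matrix (Fin (k + 2)) (Fin (k + 3)) ℂ) (X : Set (PSpace (Fin (k + 3)))) :
    Set (PSpace (Fin (k + 2))) :=
  {q | ∃ v ∈ cone X, ∃ h : M.mulVec v ≠ 0, q = Projectivization.mk ℂ (M.mulVec v) h}

/-- The index set of the Plücker coordinates on the exterior power of degree `k = m - 2` of
`Fin (k + 2) → ℂ`. -/
abbrev Plu (k : ℕ) : Type := {s : Finset (Fin (k + 2)) // s.card = k}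

/-- The extensor `w₁ ∧ ⋯ ∧ wₖ`, in Plücker coordinates (the maximal minors). -/
def extensor (w : Fin k → Fin (k + 2) → ℂ) : Plu k → ℂ := fun s =>
  Matrix.det (Matrix.of fun i j : Fin k => w j (s.1.orderEmbOfFin s.2 i))

/-- The join `e ∧ w₁ ∧ ⋯ ∧ wₖ`, an extensor of step `m - 1`, as a point of the dual space: the
linear form `v ↦ det (v, e, w₁, …, wₖ)`, whose kernel is the hyperplane spanned by
`e, w₁, …, wₖ` when these are linearly independent, and which is zero otherwise. -/
def join (e : Fin (k + 2) → ℂ) (w : Fin k → Fin (k + 2) → ℂ) : Fin (k + 2) → ℂ := fun i =>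
  Matrix.det (Matrix.of (Matrix.vecCons (Pi.single i 1) (Matrix.vecCons e w)))

/-- A matrix `F` of size `m × (m choose 2)`, given by its entries, applied to an element of the
exterior power of degree `m - 2`; the result is a linear form (an element of the exterior power
of degree `m - 1`). -/
def apply (F : Fin (k + 2) × Plu k → ℂ) (p : Plu k → ℂ) : Fin (k + 2) → ℂ := fun i =>
  ∑ s, F (i, s) * p s

/-- `F` is the fundamental matrix of order `2` of the pair of projections with matrices
`M₁, M₂`: it sends an `(m - 3)`-plane `W` to `π₂ (π₁⁻¹ W)`. If `O` spans the kernel of `M₁` (the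
first centre) and `W` is spanned by the points `M₁ Pⱼ`, then `π₁⁻¹ W` is spanned by `O` and the
`Pⱼ`, so `π₂ (π₁⁻¹ W)` is spanned by `M₂ O` (the second epipole) and the `M₂ Pⱼ`. The freedom
in the choice of `O` is the scalar up to which `F` is defined. -/
def IsFundamentalMatrix (M₁ M₂ : Matrix (Fin (k + 2)) (Fin (k + 3)) ℂ)
    (F : Fin (k + 2) × Plu k → ℂ) : Prop :=
  ∃ O : Fin (k + 3) → ℂ, O ≠ 0 ∧ M₁.mulVec O = 0 ∧
    ∀ P : Fin k → Fin (k + 3) → ℂ,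
      apply F (extensor fun j => M₁.mulVec (P j)) =
        join (M₂.mulVec O) (fun j => M₂.mulVec (P j))

/-- `M₁` and `M₂` are matrices of projections (they have full rank), and the centres of the two
projections are distinct. -/
def IsProjectionPair (M₁ M₂ : Matrix (Fin (k + 2)) (Fin (k + 3)) ℂ) : Prop :=
  M₁.rank = k + 2 ∧ M₂.rank = k + 2 ∧
    ∀ P : Fin (k + 3) → ℂ, M₁.mulVec P = 0 → M₂.mulVec P = 0 → P = 0

/-- The space of fundamental matrices of order `2`, modulo nonzero scalars. -/
def fundamentalMatrices (k : ℕ) : Set (PSpace (Fin (k + 2) × Plu k)) :=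
  {q | ∃ (F : Fin (k + 2) × Plu k → ℂ) (hF : F ≠ 0), q = Projectivization.mk ℂ F hF ∧
    ∃ M₁ M₂ : Matrix (Fin (k + 2)) (Fin (k + 3)) ℂ,
      IsProjectionPair M₁ M₂ ∧ IsFundamentalMatrix M₁ M₂ F}

/-- The generalized Kruppa equation with a nonzero scalar `lam`: for all extensors `w` of step
`m - 2`, `φ₂ (F w) = lam * φ₁ (e₁ ∧ w)`. -/
def KruppaEquation (φ₁ φ₂ : MvPolynomial (Fin (k + 2)) ℂ) (e₁ : Fin (k + 2) → ℂ)
    (F : Fin (k + 2) × Plu k → ℂ) : Prop :=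
  ∃ lam : ℂ, lam ≠ 0 ∧ ∀ w : Fin k → Fin (k + 2) → ℂ,
    MvPolynomial.eval (apply F (extensor w)) φ₂ = lam * MvPolynomial.eval (join e₁ w) φ₁

/-- The conditions on homogeneous coordinates of a triple `(e₁, F, e₂)`: `F [e₁] = 0` (that is,
`F` kills every extensor of step `m - 2` that has `e₁` as a factor), the generalized Kruppa
equation, and `Fᵀ e₂ = 0`. -/
def IsSolution (φ₁ φ₂ : MvPolynomial (Fin (k + 2)) ℂ) (e₁ : Fin (k + 2) → ℂ)
    (F : Fin (k + 2) × Plu k → ℂ) (e₂ : Fin (k + 2) → ℂ) : Prop :=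
  (∀ w : Fin k → Fin (k + 2) → ℂ, (∃ j, w j = e₁) → apply F (extensor w) = 0) ∧
  KruppaEquation φ₁ φ₂ e₁ F ∧
  (∀ s : Plu k, ∑ i, F (i, s) * e₂ i = 0)

/-- The solution variety. For the homogeneous polynomials `φ₁`, `φ₂` of two hypersurfaces the
conditions do not depend on the homogeneous coordinates that represent the three points. -/
def solutionVariety (φ₁ φ₂ : MvPolynomial (Fin (k + 2)) ℂ) :
    Set (PSpace (Fin (k + 2)) × PSpace (Fin (k + 2) × Plu k) × PSpace (Fin (k + 2))) :=
  {p | IsSolution φ₁ φ₂ p.1.rep p.2.1.rep p.2.2.rep}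

end GenKruppa

end

/-!
Write `m = k + 2`. The inequality is a parameter count on an affine chart of the cone over the
solution variety.

*Upper bound for `N`.* A fundamental matrix of order `2` is the matrix of
`w₁ ∧ ⋯ ∧ wₖ ↦ b ∧ A w₁ ∧ ⋯ ∧ A wₖ` for a vector `b` and a square matrix `A`. Adding multiples of
`b` to the columns of `A` changes nothing, so one row of `A` may be taken to be zero, and `b` may be
scaled: the cone over the fundamental matrices is covered by finitely many images of affine
`(m² - 1)`-space (`projDim_fundamentalMatrices_le`).

*Lower bound for `dim V`.* The conditions `F [e₁] = 0`, `Fᵀ e₂ = 0` say that `F` is the join with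
`e₁` followed by a linear map from the hyperplanes through `e₁` to the hyperplanes through `e₂`.
Where a fixed coordinate of `e₁` and a fixed coordinate of `e₂` do not vanish, the triples
`(e₁, F, e₂)` are parametrized by `2 m + (m - 1)²` free parameters, and all hyperplanes through `e₁`
are joins `e₁ ∧ w` with a decomposable `w`. The Kruppa equation then says that two forms in `m - 1`
variables, of the degrees of `φ₂` and `φ₁`, are proportional. If `d` is their common degree, this
takes one equation fewer than there are monomials of degree `d`, namely `(k + d).choose d - 1`
equations, near a solution where some coefficient of the form given by `φ₁` is not zero. Krull's
height theorem (`exists_indepOn_zeros`) gives the bound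
(`le_affineDim_cone₃_solutionVariety`). Dimensions are compared throughout via algebraically
independent polynomial functions (`le_affineDim`, `affineDim_le_of_subset_iUnion`).

*Two facts on dual varieties* complete the count: `φ₁` does not vanish on all hyperplanes through
`e₁` (`exists_eval_ne_zero_of_projection`), and `deg φ₁ ≤ deg X^*` (`totalDegree_le_of_projection`).
For the second, `φ₁` divides the restriction of the equation of `X^*` to the hyperplanes through
the first centre, provided that this restriction is not zero. Both follow from a special case of
biduality, `exists_eq_smul_of_dualVariety`: if the dual hypersurface of an irreducible `Z` contains
all hyperplanes through a point `e`, then `Z` is that point. Its proof differentiates the incidence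
relation. Over a field that contains the function field of the conormal variety, the generic point
`x` and the generic conormal vector `G` satisfy `∑ xⱼ dGⱼ = 0`. If the only relation among the `Gⱼ`
is linear with coefficients `e`, then `∑ eⱼ dGⱼ = 0` is, up to scalars, the only linear relation
among the `dGⱼ`, by the linear independence of the differentials of algebraically independent
elements in characteristic zero; so `x` is proportional to `e` (`mul_eq_mul_of_conormal`).

If `V` is finite, its multi-cone is a finite union of three-dimensional tori, so `dim V ≤ 0`.
-/

noncomputable section

namespace GenKruppa

open MvPolynomial

/-! ### Dimension and algebraic independence -/

section Integral

variable {R S : Type*} [CommRing R] [CommRing S] [Algebra R S]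

theorem ringKrullDim_eq_of_isIntegral [Algebra.IsIntegral R S]
    (hinj : Function.Injective (algebraMap R S)) : ringKrullDim S = ringKrullDim R := by
  apply le_antisymm
  · refine Order.krullDim_le_of_strictMono (PrimeSpectrum.comap (algebraMap R S)) ?_
    intro a b hab
    exact Ideal.IsIntegral.comap_lt_comap (R := R) (I := a.asIdeal) (J := b.asIdeal) hab
  · refine iSup_le fun l => ?_
    obtain ⟨P, -, hP, hPl⟩ := Ideal.exists_ideal_over_prime_of_isIntegral
      (S := S) l.head.asIdeal ⊥ (by
        intro x hx
        rw [Ideal.mem_comap, Ideal.mem_bot, ← map_zero (algebraMap R S)] at hx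
        rw [hinj hx]
        exact zero_mem _)
    have : P.LiesOver l.head.asIdeal := ⟨hPl.symm⟩
    obtain ⟨L, hL, -, -⟩ := Ideal.exists_ltSeries_of_hasGoingUp l P
    rw [← hL]
    exact Order.LTSeries.length_le_krullDim L

end Integral

section FiniteType

variable (K S : Type*) [Field K] [CommRing S] [Algebra K S] [Algebra.FiniteType K S] [Nontrivial S]

/-- Noether normalization, with the number of variables identified as the Krull dimension. -/
theorem exists_isIntegral_ringKrullDim :
    ∃ (s : ℕ) (g : MvPolynomial (Fin s) K →ₐ[K] S),
      Function.Injective g ∧ g.IsIntegral ∧ ringKrullDim S = s := by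
  obtain ⟨s, g, hg, hi⟩ := exists_integral_inj_algHom_of_fg K S
  refine ⟨s, g, hg, hi, ?_⟩
  algebraize [g.toRingHom]
  rw [ringKrullDim_eq_of_isIntegral (R := MvPolynomial (Fin s) K) hg,
    MvPolynomial.ringKrullDim_of_isNoetherianRing]
  simp

theorem exists_algebraicIndependent_ringKrullDim :
    ∃ (s : ℕ) (g : Fin s → S), AlgebraicIndependent K g ∧ ringKrullDim S = s := by
  obtain ⟨s, g, hg, -, hd⟩ := exists_isIntegral_ringKrullDim K S
  refine ⟨s, fun i => g (X i), ?_, hd⟩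
  have : (aeval fun i => g (X i) : MvPolynomial (Fin s) K →ₐ[K] S) = g := by
    ext i; simp
  rw [AlgebraicIndependent, this]
  exact hg

variable {K S}

/-- Independent elements bound the Krull dimension from below. The algebra need not be a domain:
pass to the quotient by a prime that avoids the nonzero polynomials in the independent elements. -/
theorem le_ringKrullDim_of_algebraicIndependent {d : ℕ} {x : Fin d → S}
    (hx : AlgebraicIndependent K x) : (d : WithBot ℕ∞) ≤ ringKrullDim S := by
  obtain ⟨s, g, hg, hi, hd⟩ := exists_isIntegral_ringKrullDim K S
  rw [hd]
  let M : Submonoid S := (nonZeroDivisors (MvPolynomial (Fin d) K)).map (aeval x)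
  obtain ⟨p, hp, -, hpM⟩ := Ideal.exists_le_prime_disjoint (⊥ : Ideal S) M (by
    rw [Set.disjoint_left]
    rintro _ h ⟨q, hq, rfl⟩
    have h0 : aeval x q = 0 := by simpa using h
    have : q = 0 := hx (by simpa using h0)
    exact nonZeroDivisors.ne_zero hq this)
  have hx' : AlgebraicIndependent K (fun i => Ideal.Quotient.mkₐ K p (x i)) := by
    rw [algebraicIndependent_iff]
    intro q hq
    by_contra hne
    have h1 : (aeval fun i => Ideal.Quotient.mkₐ K p (x i)) q
        = Ideal.Quotient.mkₐ K p (aeval x q) := by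
      rw [← AlgHom.comp_apply, comp_aeval]
    rw [h1, Ideal.Quotient.mkₐ_eq_mk, Ideal.Quotient.eq_zero_iff_mem] at hq
    exact Set.disjoint_left.mp hpM hq ⟨q, mem_nonZeroDivisors_of_ne_zero hne, rfl⟩
  let g' : MvPolynomial (Fin s) K →ₐ[K] S ⧸ p := (Ideal.Quotient.mkₐ K p).comp g
  have hg'i : ∀ y : S ⧸ p, (g' : MvPolynomial (Fin s) K →+* S ⧸ p).IsIntegralElem y := by
    intro y
    obtain ⟨y, rfl⟩ := Ideal.Quotient.mk_surjective y
    exact (hi y).map (Ideal.Quotient.mk p)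
  have halg : Algebra.IsAlgebraic (Algebra.adjoin K (Set.range fun i => g' (X i))) (S ⧸ p) := by
    have : Algebra.IsIntegral (Algebra.adjoin K (Set.range fun i => g' (X i))) (S ⧸ p) := by
      refine ⟨fun y => ?_⟩
      obtain ⟨P, hP, hy⟩ := hg'i y
      have hmem : ∀ q, g' q ∈ Algebra.adjoin K (Set.range fun i => g' (X i)) := by
        intro q
        rw [Algebra.adjoin_range_eq_range_aeval]
        refine ⟨q, ?_⟩
        have : (aeval fun i => g' (X i) : MvPolynomial (Fin s) K →ₐ[K] S ⧸ p) = g' := by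
          ext i; simp
        exact congrArg (fun f => f q) this
      let G : MvPolynomial (Fin s) K →ₐ[K] Algebra.adjoin K (Set.range fun i => g' (X i)) :=
        g'.codRestrict _ hmem
      refine ⟨P.map (G : MvPolynomial (Fin s) K →+* _), hP.map _, ?_⟩
      rw [Polynomial.eval₂_map]
      exact hy
    exact Algebra.IsIntegral.isAlgebraic
  have h1 := hx'.lift_cardinalMk_le_trdeg
  have h2 := Algebra.IsAlgebraic.trdeg_le_cardinalMk K (Set.range fun i => g' (X i))
  have h3 : Cardinal.mk (Set.range fun i => g' (X i)) ≤ (s : Cardinal) := by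
    have h4 := Cardinal.mk_range_le_lift (f := fun i : Fin s => g' (X i))
    simpa using h4
  have h4 : (d : Cardinal) ≤ Algebra.trdeg K (S ⧸ p) := by simpa using h1
  have h5 := h4.trans (h2.trans h3)
  exact_mod_cast h5

end FiniteType

section Sets

variable {ι σ : Type}

/-- The polynomials `g i` are algebraically independent as functions on the set `A`. -/
def IndepOn {d : ℕ} (A : Set (σ → ℂ)) (g : Fin d → MvPolynomial σ ℂ) : Prop :=
  ∀ P : MvPolynomial (Fin d) ℂ, (∀ x ∈ A, eval (fun i => eval x (g i)) P = 0) → P = 0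

theorem eval_eval_eq_eval_aeval {d : Type} (x : σ → ℂ) (g : d → MvPolynomial σ ℂ)
    (P : MvPolynomial d ℂ) : eval (fun i => eval x (g i)) P = eval x (aeval g P) := by
  have : (aeval fun i => eval x (g i) : MvPolynomial d ℂ →ₐ[ℂ] ℂ) = (aeval x).comp (aeval g) := by
    ext i; simp [aeval_eq_eval]
  simpa [aeval_eq_eval] using congrArg (fun f => f P) this

theorem algebraicIndependent_mk_iff {d : ℕ} {A : Set (σ → ℂ)} {g : Fin d → MvPolynomial σ ℂ} :
    AlgebraicIndependent ℂ (fun i => Ideal.Quotient.mkₐ ℂ (vanishingIdeal ℂ A) (g i))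
      ↔ IndepOn A g := by
  rw [algebraicIndependent_iff]
  refine forall_congr' fun P => ?_
  have h1 : (aeval fun i => Ideal.Quotient.mkₐ ℂ (vanishingIdeal ℂ A) (g i)) P
        = Ideal.Quotient.mkₐ ℂ _ (aeval g P) := by
      rw [← AlgHom.comp_apply, comp_aeval]
  rw [h1, Ideal.Quotient.mkₐ_eq_mk, Ideal.Quotient.eq_zero_iff_mem, mem_vanishingIdeal_iff]
  simp only [eval_eval_eq_eval_aeval, aeval_eq_eval]

theorem vanishingIdeal_ne_top {A : Set (σ → ℂ)} (hA : A.Nonempty) : vanishingIdeal ℂ A ≠ ⊤ := by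
  obtain ⟨x, hx⟩ := hA
  intro h
  have : (1 : MvPolynomial σ ℂ) ∈ vanishingIdeal ℂ A := by rw [h]; trivial
  simpa using this x hx

theorem affineDim_empty : affineDim (∅ : Set (ι → ℂ)) = 0 := by
  have : Subsingleton (MvPolynomial ι ℂ ⧸ vanishingIdeal ℂ (∅ : Set (ι → ℂ))) :=
    Ideal.Quotient.subsingleton_iff.mpr vanishingIdeal_empty
  simp [affineDim, ringKrullDim_eq_bot_of_subsingleton]

/-- Dimension does not drop under polynomial images: if the polynomial map `ρ` sends a subset of
`A` onto `B`, independent functions on `B` pull back to independent functions on `A`. -/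
theorem IndepOn.pullback {A : Set (ι → ℂ)} {B : Set (σ → ℂ)} {d : ℕ}
    {g : Fin d → MvPolynomial σ ℂ} (hg : IndepOn B g) (ρ : σ → MvPolynomial ι ℂ)
    (h : ∀ y ∈ B, ∃ x ∈ A, (fun i => eval x (ρ i)) = y) :
    IndepOn A (fun i => aeval ρ (g i)) := by
  intro P hP
  refine hg P fun y hy => ?_
  obtain ⟨x, hx, rfl⟩ := h y hy
  simpa only [eval_eval_eq_eval_aeval] using hP x hx

variable [Fintype ι]

theorem exists_indepOn_affineDim {A : Set (ι → ℂ)} (hA : A.Nonempty) :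
    ∃ (d : ℕ) (g : Fin d → MvPolynomial ι ℂ), IndepOn A g ∧ affineDim A = d := by
  have := Ideal.Quotient.nontrivial_iff.mpr (vanishingIdeal_ne_top hA)
  obtain ⟨s, g, hg, hd⟩ :=
    exists_algebraicIndependent_ringKrullDim ℂ (MvPolynomial ι ℂ ⧸ vanishingIdeal ℂ A)
  choose G hG using fun i => Ideal.Quotient.mk_surjective (g i)
  refine ⟨s, G, ?_, ?_⟩
  · rw [← algebraicIndependent_mk_iff]
    simpa [Ideal.Quotient.mkₐ_eq_mk, hG] using hg
  · simp only [affineDim, hd]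
    rfl

theorem le_affineDim {A : Set (ι → ℂ)} (hA : A.Nonempty) {d : ℕ} {g : Fin d → MvPolynomial ι ℂ}
    (hg : IndepOn A g) : (d : ℤ) ≤ affineDim A := by
  have := Ideal.Quotient.nontrivial_iff.mpr (vanishingIdeal_ne_top hA)
  have h := le_ringKrullDim_of_algebraicIndependent (algebraicIndependent_mk_iff.mpr hg)
  obtain ⟨s, -, -, hd⟩ :=
    exists_algebraicIndependent_ringKrullDim ℂ (MvPolynomial ι ℂ ⧸ vanishingIdeal ℂ A)
  rw [hd] at h
  have h' : affineDim A = s := by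
    simp only [affineDim, hd]
    rfl
  rw [h']
  exact_mod_cast h

/-- A set covered by finitely many polynomial images of an affine space has at most the dimension
of that affine space. -/
theorem affineDim_le_of_subset_iUnion {A : Set (ι → ℂ)} {τ : Type} [Fintype τ]
    {T : Type*} [Finite T] (p : T → ι → MvPolynomial τ ℂ)
    (h : ∀ x ∈ A, ∃ t y, x = fun i => eval y (p t i)) : affineDim A ≤ Fintype.card τ := by
  rcases A.eq_empty_or_nonempty with rfl | hA
  · rw [affineDim_empty]
    positivity
  obtain ⟨d, g, hg, hd⟩ := exists_indepOn_affineDim hA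
  rw [hd]
  cases nonempty_fintype T
  obtain ⟨t, ht⟩ : ∃ t, AlgebraicIndependent ℂ (fun i => aeval (p t) (g i)) := by
    by_contra! hcon
    have hP : ∀ t, ∃ P : MvPolynomial (Fin d) ℂ,
        aeval (fun i => aeval (p t) (g i)) P = 0 ∧ P ≠ 0 := by
      intro t
      have := hcon t
      rw [algebraicIndependent_iff] at this
      push Not at this
      exact this
    choose P hP hne using hP
    refine Finset.prod_ne_zero_iff.mpr (fun t (_ : t ∈ Finset.univ) => hne t) (hg _ ?_)
    intro x hx
    obtain ⟨t, y, rfl⟩ := h x hx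
    rw [map_prod]
    refine Finset.prod_eq_zero (Finset.mem_univ t) ?_
    have := congrArg (eval y) (hP t)
    rw [map_zero, ← eval_eval_eq_eval_aeval] at this
    simpa only [← eval_eval_eq_eval_aeval] using this
  have h1 := ht.lift_cardinalMk_le_trdeg
  rw [MvPolynomial.trdeg_of_isDomain] at h1
  simpa using h1

end Sets

section Krull

/-- All closed points of an affine space have the height of its dimension. -/
theorem height_eq_card_of_isMaximal (K : Type*) [Field K] {σ : Type*} [Finite σ]
    (P : Ideal (MvPolynomial σ K)) [P.IsMaximal] : P.height = Nat.card σ := by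
  induction σ using Finite.induction_empty_option with
  | @of_equiv α β e H =>
    let f : MvPolynomial α K ≃+* MvPolynomial β K := (renameEquiv K e).toRingEquiv
    have : (P.comap f).IsMaximal := Ideal.comap_isMaximal_of_equiv f
    rw [← Nat.card_congr e, ← H (P.comap f), RingEquiv.height_comap]
  | h_empty =>
    have hF : IsField (MvPolynomial PEmpty K) :=
      (isEmptyRingEquiv K PEmpty).toMulEquiv.isField (Field.toIsField K)
    let := hF.toField
    rw [Ideal.eq_bot_of_prime P, Ideal.height_bot]
    simp
  | @h_option α _ H =>
    let f : MvPolynomial (Option α) K ≃+* Polynomial (MvPolynomial α K) :=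
      (optionEquivLeft K α).toRingEquiv
    have h1 : (P.comap f.symm).IsMaximal := Ideal.comap_isMaximal_of_equiv f.symm
    have h2 : ((P.comap f.symm).comap Polynomial.C).IsMaximal :=
      Polynomial.isMaximal_comap_C_of_isJacobsonRing _
    have h3 : (P.comap f.symm).LiesOver ((P.comap f.symm).comap Polynomial.C) := ⟨rfl⟩
    rw [← RingEquiv.height_comap f.symm P, Polynomial.height_eq_height_add_one
      ((P.comap f.symm).comap Polynomial.C) (P.comap f.symm), H]
    simp

/-- Krull's height theorem in geometric form: near a common zero, `s` equations in affine
`M`-space cut out a set on which at least `M - s` functions are independent. -/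
theorem exists_indepOn_zeros {σ : Type} [Fintype σ] {E : Type*} [Finite E]
    (h : E → MvPolynomial σ ℂ) (Δ : MvPolynomial σ ℂ) (x₀ : σ → ℂ)
    (h₀ : ∀ e, eval x₀ (h e) = 0) (hΔ : eval x₀ Δ ≠ 0) :
    ∃ (d : ℕ) (g : Fin d → MvPolynomial σ ℂ), Nat.card σ ≤ d + Nat.card E ∧
      IndepOn {x | (∀ e, eval x (h e) = 0) ∧ eval x Δ ≠ 0} g := by
  let m : Ideal (MvPolynomial σ ℂ) := vanishingIdeal ℂ {x₀}
  have hmax : m.IsMaximal := isMaximal_iff_eq_vanishingIdeal_singleton.mpr ⟨x₀, rfl⟩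
  have hm : ∀ q, q ∈ m ↔ eval x₀ q = 0 := by
    intro q
    simp [m, mem_vanishingIdeal_iff, aeval_eq_eval]
  have hsub : Set.range h ⊆ m := by
    rintro _ ⟨e, rfl⟩
    exact (hm _).mpr (h₀ e)
  set I := Ideal.span (Set.range h) with hI
  have hIm : I ≤ m := Ideal.span_le.mpr hsub
  have h1 := Ideal.height_le_height_add_encard_of_subset (Set.range h) hsub
  rw [height_eq_card_of_isMaximal, ← hI] at h1
  have hprime : (m.map (Ideal.Quotient.mk I)).IsPrime := Ideal.isPrime_map_quotientMk_of_isPrime hIm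
  obtain ⟨l, hl, hlen⟩ := Ideal.exists_ltSeries_length_eq_height (m.map (Ideal.Quotient.mk I))
  rw [← hlen] at h1
  have h2 : (Set.range h).encard ≤ Nat.card E := by
    rw [← Set.image_univ]
    refine (Set.encard_image_le h Set.univ).trans ?_
    rw [Set.encard_univ, ENat.card_eq_coe_natCard]
  have h3 : Nat.card σ ≤ l.length + Nat.card E := by
    have := h1.trans (add_le_add_right h2 _)
    exact_mod_cast this
  -- a longest chain of primes below the point `x₀` begins with a component through `x₀` of large
  -- dimension, and `Δ` does not vanish on that component
  let Q := (MvPolynomial σ ℂ ⧸ I) ⧸ l.head.asIdeal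
  have hdim : (l.length : WithBot ℕ∞) ≤ ringKrullDim Q := by
    rw [ringKrullDim_quotient]
    have hz : ∀ i, l.toFun i ∈ PrimeSpectrum.zeroLocus (l.head.asIdeal : Set _) := by
      intro i
      rw [PrimeSpectrum.mem_zeroLocus]
      exact l.monotone (Fin.zero_le i)
    let L : LTSeries (PrimeSpectrum.zeroLocus (l.head.asIdeal : Set (MvPolynomial σ ℂ ⧸ I))) :=
      { length := l.length
        toFun := fun i => ⟨l.toFun i, hz i⟩
        step := fun i => l.step i }
    exact Order.LTSeries.length_le_krullDim L
  obtain ⟨d, g, hg, hd⟩ := exists_algebraicIndependent_ringKrullDim ℂ Q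
  rw [hd] at hdim
  have hdim' : l.length ≤ d := by exact_mod_cast hdim
  let π : MvPolynomial σ ℂ →ₐ[ℂ] Q :=
    (Ideal.Quotient.mkₐ ℂ l.head.asIdeal).comp (Ideal.Quotient.mkₐ ℂ I)
  have hπ : Function.Surjective π :=
    (Ideal.Quotient.mkₐ_surjective ℂ _).comp (Ideal.Quotient.mkₐ_surjective ℂ _)
  choose G hG using fun i => hπ (g i)
  refine ⟨d, G, by omega, fun P hP => ?_⟩
  let J : Ideal (MvPolynomial σ ℂ) := RingHom.ker π
  have hJ : J.IsPrime := RingHom.ker_isPrime _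
  have hIJ : ∀ e, h e ∈ J := by
    intro e
    have : Ideal.Quotient.mkₐ ℂ I (h e) = 0 := by
      rw [Ideal.Quotient.mkₐ_eq_mk, Ideal.Quotient.eq_zero_iff_mem]
      exact Ideal.subset_span ⟨e, rfl⟩
    change π (h e) = 0
    simp only [π, AlgHom.comp_apply, this, map_zero]
  have hJm : J ≤ m := by
    intro q hq
    change π q = 0 at hq
    simp only [π, AlgHom.comp_apply, Ideal.Quotient.mkₐ_eq_mk] at hq
    rw [Ideal.Quotient.eq_zero_iff_mem] at hq
    have hle : l.head ≤ l.last := l.head_le_last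
    have hq' := hle hq
    rw [hl] at hq'
    rcases (Ideal.mem_map_iff_of_surjective _ Ideal.Quotient.mk_surjective).mp hq' with ⟨r, hr, hrq⟩
    rw [Ideal.Quotient.eq] at hrq
    have := m.sub_mem hr (hIm hrq)
    simpa using this
  have hΔJ : Δ ∉ J := fun hc => hΔ ((hm _).mp (hJm hc))
  have hmem : Δ * aeval G P ∈ J := by
    rw [← IsPrime.vanishingIdeal_zeroLocus (K := ℂ) J, mem_vanishingIdeal_iff]
    intro x hx
    rw [aeval_eq_eval, map_mul]
    by_cases hc : eval x Δ = 0
    · rw [hc, zero_mul]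
    · have := hP x ⟨fun e => by simpa [aeval_eq_eval] using hx _ (hIJ e), hc⟩
      rw [eval_eval_eq_eval_aeval] at this
      rw [this, mul_zero]
  have hz : π (aeval G P) = 0 := (hJ.mem_or_mem hmem).resolve_left hΔJ
  have : aeval g P = 0 := by
    rw [← hz, ← AlgHom.comp_apply, comp_aeval]
    simp only [hG]
  exact hg (by rw [this, map_zero])

end Krull

/-! ### Differentials of algebraically independent elements -/

section Kaehler

open KaehlerDifferential

/-- The field `K` is formally étale over the polynomial ring in the elements of the basis, being
a separable algebraic extension of its field of fractions. -/
theorem linearIndependent_D_of_isTranscendenceBasis {F K ι : Type*} [Field F] [CharZero F] [Field K]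
    [Algebra F K] {x : ι → K} (hx : IsTranscendenceBasis F x) :
    LinearIndependent K fun i => D F K (x i) := by
  let S := MvPolynomial ι F
  let : Algebra S K := (aeval x : S →ₐ[F] K).toRingHom.toAlgebra
  have hST : IsScalarTower F S K := IsScalarTower.of_algebraMap_eq fun r => by
    simp [S, RingHom.algebraMap_toAlgebra]
  have hinj : Function.Injective (algebraMap S K) := hx.1
  have : FaithfulSMul S K := (faithfulSMul_iff_algebraMap_injective S K).mpr hinj
  have halg : Algebra.IsAlgebraic S K := by
    have := hx.isAlgebraic
    refine Algebra.IsAlgebraic.of_ringHom_of_comp_eq hx.1.aevalEquiv (RingHom.id K)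
      hx.1.aevalEquiv.surjective Function.injective_id ?_
    ext r
    · simpa [S] using IsScalarTower.algebraMap_apply F S K r
    · simp [S, RingHom.algebraMap_toAlgebra]
  let := FractionRing.liftAlgebra S K
  have : IsScalarTower S (FractionRing S) K := FractionRing.isScalarTower_liftAlgebra S K
  have : Algebra.IsAlgebraic (FractionRing S) K :=
    (IsFractionRing.comap_isAlgebraic_iff (A := S)).mp halg
  have : CharZero S := inferInstanceAs (CharZero (MvPolynomial ι F))
  have : CharZero (FractionRing S) := IsFractionRing.charZero S
  have : Algebra.FormallyEtale S (FractionRing S) :=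
    Algebra.FormallyEtale.of_isLocalization (nonZeroDivisors S)
  have : Algebra.FormallyEtale (FractionRing S) K := Algebra.FormallyEtale.of_isSeparable _ _
  have : Algebra.FormallyEtale S K := Algebra.FormallyEtale.comp S (FractionRing S) K
  let b := ((mvPolynomialBasis F ι).baseChange K).map (tensorKaehlerEquivOfFormallyEtale F S K)
  have hb : ∀ i, b i = D F K (x i) := by
    intro i
    have h := tensorKaehlerEquivOfFormallyEtale_symm_D_algebraMap F S K (X i)
    rw [LinearEquiv.symm_apply_eq] at h
    simp only [b, Module.Basis.map_apply, Module.Basis.baseChange_apply, mvPolynomialBasis_apply]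
    rw [← h]
    simp [S, RingHom.algebraMap_toAlgebra]
  rw [← funext hb]
  exact b.linearIndependent

/-- In characteristic zero, algebraically independent elements of a field extension have linearly
independent differentials. -/
theorem linearIndependent_D {F K ι : Type*} [Field F] [CharZero F] [Field K]
    [Algebra F K] {x : ι → K} (hx : AlgebraicIndependent F x) :
    LinearIndependent K fun i => D F K (x i) := by
  obtain ⟨t, hst, ht⟩ := exists_isTranscendenceBasis_superset (s := Set.range x) hx.to_subtype_range
  have h := linearIndependent_D_of_isTranscendenceBasis ht
  exact h.comp (fun i => (⟨x i, hst ⟨i, rfl⟩⟩ : t)) fun i j hij =>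
    hx.injective (congrArg Subtype.val hij)

theorem D_aeval {F K ι : Type*} [Fintype ι] [Field F] [Field K] [Algebra F K] (x : ι → K)
    (f : MvPolynomial ι F) :
    D F K (aeval x f) = ∑ j, aeval x (pderiv j f) • D F K (x j) := by
  classical
  induction f using MvPolynomial.induction_on with
  | C a => simp
  | add p q hp hq => simp only [map_add, hp, hq, add_smul, Finset.sum_add_distrib]
  | mul_X p i hp =>
    simp only [map_mul, aeval_X, Derivation.leibniz, hp, pderiv_X, smul_eq_mul, map_add, add_smul,
      Finset.sum_add_distrib, Finset.smul_sum, smul_smul]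
    congr 1
    rw [Finset.sum_eq_single i]
    · simp
    · intro b _ hb
      simp [hb.symm]
    · simp

/-- If `rank + dim` exceeded the number of variables, the relations `df = 0` and the differentials
of a transcendence family would together be too many in the space of differentials. -/
theorem add_le_card_of_linearIndependent {K ι : Type*} [Fintype ι] [Field K] [Algebra ℂ K]
    (x : ι → K) {s d : ℕ} (f : Fin s → MvPolynomial ι ℂ) (hf : ∀ i, aeval x (f i) = 0)
    (hli : LinearIndependent K fun i j => aeval x (pderiv j (f i)))
    (g : Fin d → MvPolynomial ι ℂ) (hg : AlgebraicIndependent ℂ fun i => aeval x (g i)) :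
    s + d ≤ Fintype.card ι := by
  let T : (ι → K) →ₗ[K] Ω[K⁄ℂ] := Fintype.linearCombination K fun j => D ℂ K (x j)
  have hT : ∀ q : MvPolynomial ι ℂ, T (fun j => aeval x (pderiv j q)) = D ℂ K (aeval x q) := by
    intro q
    rw [D_aeval]
    rfl
  have h1 : s ≤ Module.finrank K (LinearMap.ker T) := by
    let y : Fin s → LinearMap.ker T := fun i => ⟨fun j => aeval x (pderiv j (f i)), by
      rw [LinearMap.mem_ker, hT, hf, map_zero]⟩
    have hy : LinearIndependent K y :=
      LinearIndependent.of_comp (LinearMap.ker T).subtype hli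
    simpa using hy.fintype_card_le_finrank
  have h2 : d ≤ Module.finrank K (LinearMap.range T) := by
    let y : Fin d → LinearMap.range T := fun i => ⟨D ℂ K (aeval x (g i)), _, hT (g i)⟩
    have hy : LinearIndependent K y :=
      LinearIndependent.of_comp (LinearMap.range T).subtype (linearIndependent_D hg)
    simpa using hy.fintype_card_le_finrank
  have h3 := LinearMap.finrank_range_add_finrank_ker T
  rw [Module.finrank_fintype_fun_eq_card] at h3
  omega

/-- The algebraic core of biduality. The point `x` and the conormal vector `G` satisfy
`∑ xⱼ dGⱼ = 0`; if the only relation among the `Gⱼ` is linear, with coefficients `e`, then `x` is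
proportional to `e`. -/
theorem mul_eq_mul_of_conormal {K ι : Type*} [Fintype ι] [Field K] [Algebra ℂ K]
    (x : ι → K) {r : ℕ} (t : Fin r → K) (f : Fin r → MvPolynomial ι ℂ)
    (hf : ∀ i, aeval x (f i) = 0)
    (hE : ∀ i, ∑ j, x j * aeval x (pderiv j (f i)) = 0)
    (e : ι → ℂ) (a : ι) (ha : e a ≠ 0)
    (he : ∑ j, algebraMap ℂ K (e j) * (∑ i, t i * aeval x (pderiv j (f i))) = 0)
    (hG : AlgebraicIndependent ℂ fun j : {j // j ≠ a} =>
      ∑ i, t i * aeval x (pderiv j.1 (f i))) (j : ι) :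
    algebraMap ℂ K (e a) * x j = algebraMap ℂ K (e j) * x a := by
  classical
  set G : ι → K := fun j => ∑ i, t i * aeval x (pderiv j (f i)) with hGdef
  have h1 : ∑ j, G j • D ℂ K (x j) = 0 := by
    calc ∑ j, G j • D ℂ K (x j)
        = ∑ i, t i • ∑ j, aeval x (pderiv j (f i)) • D ℂ K (x j) := by
          simp only [hGdef, Finset.sum_smul, Finset.smul_sum, smul_smul]
          exact Finset.sum_comm
      _ = 0 := Finset.sum_eq_zero fun i _ => by rw [← D_aeval, hf, map_zero, smul_zero]
  have h2 : ∑ j, x j * G j = 0 := by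
    calc ∑ j, x j * G j = ∑ i, t i * ∑ j, x j * aeval x (pderiv j (f i)) := by
          simp only [hGdef, Finset.mul_sum]
          rw [Finset.sum_comm]
          refine Finset.sum_congr rfl fun i _ => Finset.sum_congr rfl fun j _ => by ring
      _ = 0 := Finset.sum_eq_zero fun i _ => by rw [hE, mul_zero]
  have h3 : ∑ j, x j • D ℂ K (G j) = 0 := by
    have h := congrArg (D ℂ K) h2
    simpa only [map_sum, Derivation.leibniz, Finset.sum_add_distrib, h1, add_zero, map_zero]
      using h
  have h4 : ∑ j, algebraMap ℂ K (e j) • D ℂ K (G j) = 0 := by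
    have h : D ℂ K (∑ j, algebraMap ℂ K (e j) * G j) = D ℂ K 0 := congrArg (D ℂ K) he
    simpa only [map_sum, Derivation.leibniz, Derivation.map_algebraMap, smul_zero, add_zero,
      map_zero] using h
  have h5 : ∑ j : {j // j ≠ a},
      (algebraMap ℂ K (e a) * x j - algebraMap ℂ K (e j) * x a) • D ℂ K (G j) = 0 := by
    have h : ∑ j, (algebraMap ℂ K (e a) * x j - algebraMap ℂ K (e j) * x a) • D ℂ K (G j) = 0 := by
      have e1 : algebraMap ℂ K (e a) • ∑ j, x j • D ℂ K (G j)
        - x a • ∑ j, algebraMap ℂ K (e j) • D ℂ K (G j) = 0 := by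
        rw [h3, h4, smul_zero, smul_zero, sub_zero]
      rw [← e1, Finset.smul_sum, Finset.smul_sum, ← Finset.sum_sub_distrib]
      refine Finset.sum_congr rfl fun j _ => ?_
      rw [smul_smul, smul_smul, ← sub_smul, mul_comm (x a)]
    rw [← Finset.sum_erase (a := a) Finset.univ (by rw [sub_self, zero_smul])] at h
    rw [← h]
    exact (Finset.sum_subtype (p := fun j => j ≠ a) (Finset.univ.erase a) (by simp) fun j =>
      (algebraMap ℂ K (e a) * x j - algebraMap ℂ K (e j) * x a) • D ℂ K (G j)).symm
  rcases eq_or_ne j a with rfl | hj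
  · rfl
  · exact sub_eq_zero.mp
      (Fintype.linearIndependent_iff.mp (linearIndependent_D hG) _ h5 ⟨j, hj⟩)

end Kaehler

/-! ### Cones, tangent spaces and conormal vectors -/

section Cones

variable {ι : Type}

theorem ne_zero_of_mem_cone {Z : Set (PSpace ι)} {v : ι → ℂ} (hv : v ∈ cone Z) : v ≠ 0 := hv.1

theorem mk_smul {v : ι → ℂ} (hv : v ≠ 0) {t : ℂ} (ht : t ≠ 0) :
    Projectivization.mk ℂ (t • v) (smul_ne_zero ht hv) = Projectivization.mk ℂ v hv := by
  rw [Projectivization.mk_eq_mk_iff']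
  exact ⟨t, rfl⟩

theorem smul_mem_cone {Z : Set (PSpace ι)} {v : ι → ℂ} (hv : v ∈ cone Z) {t : ℂ} (ht : t ≠ 0) :
    t • v ∈ cone Z := by
  obtain ⟨h0, h⟩ := hv
  exact ⟨smul_ne_zero ht h0, by rwa [mk_smul h0 ht]⟩

theorem rep_mem_cone {Z : Set (PSpace ι)} {p : PSpace ι} (hp : p ∈ Z) : p.rep ∈ cone Z :=
  ⟨p.rep_nonzero, by rwa [Projectivization.mk_rep]⟩

theorem exists_smul_rep {v : ι → ℂ} (hv : v ≠ 0) :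
    ∃ t : ℂ, t ≠ 0 ∧ v = t • (Projectivization.mk ℂ v hv).rep := by
  obtain ⟨a, ha⟩ := Projectivization.exists_smul_eq_mk_rep ℂ v hv
  refine ⟨(a⁻¹ : ℂˣ), Units.ne_zero _, ?_⟩
  rw [← ha, Units.smul_def, smul_smul]
  simp

theorem mem_ideal {Z : Set (PSpace ι)} {f : MvPolynomial ι ℂ} :
    f ∈ ideal Z ↔ ∀ v ∈ cone Z, eval v f = 0 := by
  simp [ideal, mem_vanishingIdeal_iff, aeval_eq_eval]

theorem cone_nonempty_of_ideal_ne_top {Z : Set (PSpace ι)} (h : ideal Z ≠ ⊤) :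
    (cone Z).Nonempty := by
  by_contra hne
  rw [Set.not_nonempty_iff_eq_empty] at hne
  exact h (by rw [ideal, hne, vanishingIdeal_empty])

/-- The polynomial `f` with all variables scaled by `t`. -/
def scaleVars (t : ℂ) : MvPolynomial ι ℂ →ₐ[ℂ] MvPolynomial ι ℂ := aeval fun i => C t * X i

theorem eval_scaleVars (t : ℂ) (v : ι → ℂ) (f : MvPolynomial ι ℂ) :
    eval v (scaleVars t f) = eval (t • v) f := by
  rw [scaleVars, ← eval_eval_eq_eval_aeval]
  congr 2
  ext i
  simp

theorem ideal_zariskiClosure (S : Set (PSpace ι)) : ideal (zariskiClosure S) = ideal S := by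
  apply le_antisymm
  · intro f hf
    rw [mem_ideal] at hf ⊢
    intro v ⟨hv, hvS⟩
    refine hf v ⟨hv, fun g hg => ?_⟩
    exact mem_ideal.mp hg _ (rep_mem_cone hvS)
  · intro f hf
    rw [mem_ideal]
    intro v ⟨hv, hvS⟩
    obtain ⟨t, ht, hvt⟩ := exists_smul_rep hv
    rw [hvt, ← eval_scaleVars]
    refine hvS _ (mem_ideal.mpr fun w hw => ?_)
    rw [eval_scaleVars]
    exact mem_ideal.mp hf _ (smul_mem_cone hw ht)

end Cones

section Tangent

variable {ι : Type}

theorem projDim_add_one (Z : Set (PSpace ι)) : projDim Z + 1 = affineDim (cone Z) := by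
  rw [projDim]; ring

/-- The gradient of `f` at `v`, as a linear map in `f`. -/
def gradient (v : ι → ℂ) : MvPolynomial ι ℂ →ₗ[ℂ] (ι → ℂ) where
  toFun f i := eval v (pderiv i f)
  map_add' f g := by ext i; simp
  map_smul' t f := by ext i; simp

/-- The conormal space to `Z` at `v`: all gradients at `v` of polynomials that vanish on `Z`. -/
def conormalSpace (Z : Set (PSpace ι)) (v : ι → ℂ) : Submodule ℂ (ι → ℂ) :=
  ((ideal Z).restrictScalars ℂ).map (gradient v)

variable [Fintype ι]

open Classical in
theorem tangentSpace_eq (Z : Set (PSpace ι)) (v : ι → ℂ) :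
    tangentSpace Z v
      = ((conormalSpace Z v).map (dotProductEquiv ℂ ι).toLinearMap).dualCoannihilator := by
  ext u
  rw [Submodule.mem_dualCoannihilator]
  constructor
  · rintro hu _ ⟨_, ⟨f, hf, rfl⟩, rfl⟩
    exact hu f hf
  · intro hu f hf
    exact hu _ ⟨_, ⟨f, hf, rfl⟩, rfl⟩

theorem finrank_conormalSpace_add_finrank_tangentSpace (Z : Set (PSpace ι)) (v : ι → ℂ) :
    Module.finrank ℂ (conormalSpace Z v) + Module.finrank ℂ (tangentSpace Z v)
      = Fintype.card ι := by
  classical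
  rw [tangentSpace_eq, ← LinearEquiv.finrank_map_eq (dotProductEquiv ℂ ι) (conormalSpace Z v)]
  have := Subspace.finrank_add_finrank_dualCoannihilator_eq
    ((conormalSpace Z v).map (dotProductEquiv ℂ ι).toLinearMap)
  rw [Module.finrank_fintype_fun_eq_card] at this
  exact this

theorem mem_conormalSpace_iff {Z : Set (PSpace ι)} {v h : ι → ℂ} :
    h ∈ conormalSpace Z v ↔ ∀ u ∈ tangentSpace Z v, h ⬝ᵥ u = 0 := by
  classical
  constructor
  · rintro ⟨f, hf, rfl⟩ u hu
    exact hu f hf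
  · intro H
    have h1 : dotProductEquiv ℂ ι h ∈ (tangentSpace Z v).dualAnnihilator := by
      rw [Submodule.mem_dualAnnihilator]
      exact H
    rw [tangentSpace_eq, Subspace.dualCoannihilator_dualAnnihilator_eq] at h1
    obtain ⟨h', hh', he⟩ := h1
    rwa [← (dotProductEquiv ℂ ι).injective he]

/-- A matrix with linearly independent rows has a right inverse. -/
theorem exists_matrix_mul_eq_one {s : ℕ} {y : Fin s → ι → ℂ} (hy : LinearIndependent ℂ y) :
    ∃ Q : Matrix ι (Fin s) ℂ, Matrix.of y * Q = 1 := by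
  classical
  obtain ⟨g, hg⟩ := (Fintype.linearCombination ℂ y).exists_leftInverse_of_injective
    (LinearMap.ker_eq_bot.mpr (hy.fintypeLinearCombination_injective))
  refine ⟨Matrix.of fun j l => g (Pi.single j 1) l, ?_⟩
  ext i l
  have h1 : g (y i) = Pi.single i 1 := by
    have := congrArg (fun F => F (Pi.single i 1)) hg
    simpa using this
  have h2 : y i = ∑ j, y i j • (Pi.single j (1 : ℂ) : ι → ℂ) := pi_eq_sum_univ' (y i)
  rw [Matrix.mul_apply]
  simp only [Matrix.of_apply]
  have h3 : g (y i) l = ∑ j, y i j * g (Pi.single j 1) l := by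
    conv_lhs => rw [h2]
    simp [map_sum, Finset.sum_apply]
  rw [← h3, h1, Matrix.one_apply, Pi.single_apply]
  simp [eq_comm]

/-- A combination of minors of the Jacobian matrix: the determinant of the product of the rows
`∂f₁, …, ∂fₛ` with a constant matrix `Q`. -/
def jacobianDet {s : ℕ} (f : Fin s → MvPolynomial ι ℂ) (Q : Matrix ι (Fin s) ℂ) :
    MvPolynomial ι ℂ :=
  Matrix.det (Matrix.of fun i l => ∑ j, pderiv j (f i) * C (Q j l))

theorem eval_jacobianDet {s : ℕ} (f : Fin s → MvPolynomial ι ℂ) (Q : Matrix ι (Fin s) ℂ)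
    (v : ι → ℂ) :
    eval v (jacobianDet f Q)
      = Matrix.det ((Matrix.of fun i => gradient v (f i) : Matrix (Fin s) ι ℂ) * Q) := by
  rw [jacobianDet, RingHom.map_det, RingHom.mapMatrix_apply]
  congr 1
  ext i j
  simp [Matrix.mul_apply, gradient]

theorem linearIndependent_of_det_mul_ne_zero {K : Type*} [Field K] {s : ℕ} {y : Fin s → ι → K}
    {Q : Matrix ι (Fin s) K} (h : (Matrix.of y * Q).det ≠ 0) : LinearIndependent K y := by
  have h1 : LinearIndependent K (Matrix.of y).row := by
    rw [← Matrix.vecMul_injective_iff]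
    have h2 := Matrix.vecMul_injective_of_isUnit
      ((Matrix.isUnit_iff_isUnit_det _).mpr (isUnit_iff_ne_zero.mpr h))
    intro c c' hc
    apply h2
    simp only [← Matrix.vecMul_vecMul]
    exact congrArg (fun w => Matrix.vecMul w Q) hc
  exact h1

/-- If a minor of the Jacobian matrix of `s` polynomials that vanish on an irreducible variety does
not vanish on it, then the variety has codimension at least `s`. -/
theorem add_affineDim_le_of_jacobianDet {Z : Set (PSpace ι)} (hZ : (ideal Z).IsPrime) {s : ℕ}
    {f : Fin s → MvPolynomial ι ℂ} (hf : ∀ i, f i ∈ ideal Z) {Q : Matrix ι (Fin s) ℂ}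
    (hQ : jacobianDet f Q ∉ ideal Z) : s + affineDim (cone Z) ≤ Fintype.card ι := by
  obtain ⟨d, g, hg, hd⟩ := exists_indepOn_affineDim (cone_nonempty_of_ideal_ne_top hZ.ne_top)
  rw [hd]
  let A := MvPolynomial ι ℂ ⧸ ideal Z
  let K := FractionRing A
  let π : MvPolynomial ι ℂ →ₐ[ℂ] K :=
    (IsScalarTower.toAlgHom ℂ A K).comp (Ideal.Quotient.mkₐ ℂ (ideal Z))
  have hπ : ∀ q, π q = 0 ↔ q ∈ ideal Z := by
    intro q
    simp only [π, AlgHom.comp_apply, IsScalarTower.toAlgHom_apply]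
    rw [map_eq_zero_iff _ (IsFractionRing.injective A K)]
    exact Ideal.Quotient.eq_zero_iff_mem
  let x : ι → K := fun j => π (X j)
  have hx : aeval x = π := by ext j; simp [x]
  have h := add_le_card_of_linearIndependent x f (fun i => by rw [hx, hπ]; exact hf i) ?_ g ?_
  · exact_mod_cast h
  · have h1 : ((Matrix.of fun i j => aeval x (pderiv j (f i)) : Matrix (Fin s) ι K)
        * Q.map (algebraMap ℂ K)).det
        = π (jacobianDet f Q) := by
      rw [jacobianDet, AlgHom.map_det, AlgHom.mapMatrix_apply]
      congr 1
      ext i j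
      have hC : ∀ c, π (C c) = algebraMap ℂ K c := fun c => π.commutes c
      simp [Matrix.mul_apply, hx, hC]
    refine linearIndependent_of_det_mul_ne_zero (Q := Q.map (algebraMap ℂ K)) ?_
    rw [h1]
    exact fun hc => hQ ((hπ _).mp hc)
  · have h1 := algebraicIndependent_mk_iff.mpr hg
    have h2 := h1.map' (f := IsScalarTower.toAlgHom ℂ A K) (IsFractionRing.injective A K)
    rw [hx]
    exact h2

theorem exists_linearIndependent_gradient (Z : Set (PSpace ι)) (v : ι → ℂ) {s : ℕ}
    (hs : s = Module.finrank ℂ (conormalSpace Z v)) :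
    ∃ f : Fin s → MvPolynomial ι ℂ, (∀ i, f i ∈ ideal Z) ∧
      LinearIndependent ℂ fun i => gradient v (f i) := by
  subst hs
  let b := Module.finBasis ℂ (conormalSpace Z v)
  choose f hf hfb using fun i => (b i).2
  refine ⟨f, hf, ?_⟩
  rw [funext hfb]
  exact b.linearIndependent.map' (conormalSpace Z v).subtype (Submodule.ker_subtype _)

/-- The tangent spaces of an irreducible variety have at least the dimension of the variety. -/
theorem finrank_conormalSpace_add_affineDim_le {Z : Set (PSpace ι)} (hZ : (ideal Z).IsPrime)
    {v : ι → ℂ} (hv : v ∈ cone Z) :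
    Module.finrank ℂ (conormalSpace Z v) + affineDim (cone Z) ≤ Fintype.card ι := by
  obtain ⟨f, hf, hli⟩ := exists_linearIndependent_gradient Z v rfl
  obtain ⟨Q, hQ⟩ := exists_matrix_mul_eq_one hli
  refine add_affineDim_le_of_jacobianDet hZ hf (Q := Q) fun hmem => ?_
  have := mem_ideal.mp hmem v hv
  rw [eval_jacobianDet, hQ, Matrix.det_one] at this
  exact one_ne_zero this

theorem isSmoothAt_iff {Z : Set (PSpace ι)} {v : ι → ℂ} :
    IsSmoothAt Z v ↔
      (Module.finrank ℂ (conormalSpace Z v) : ℤ) + affineDim (cone Z) = Fintype.card ι := by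
  have h := finrank_conormalSpace_add_finrank_tangentSpace Z v
  rw [IsSmoothAt, projDim_add_one]
  omega

/-- The smooth points of an irreducible variety contain a neighbourhood of any given one. -/
theorem exists_smooth_of_eval_ne_zero {Z : Set (PSpace ι)} (hZ : (ideal Z).IsPrime)
    {v₀ : ι → ℂ} (hv₀ : v₀ ∈ cone Z) (hs : IsSmoothAt Z v₀) :
    ∃ Δ ∉ ideal Z, ∀ v ∈ cone Z, eval v Δ ≠ 0 → IsSmoothAt Z v := by
  obtain ⟨f, hf, hli⟩ := exists_linearIndependent_gradient Z v₀ rfl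
  obtain ⟨Q, hQ⟩ := exists_matrix_mul_eq_one hli
  refine ⟨jacobianDet f Q, fun hmem => ?_, fun v hv hne => ?_⟩
  · have := mem_ideal.mp hmem v₀ hv₀
    rw [eval_jacobianDet, hQ, Matrix.det_one] at this
    exact one_ne_zero this
  · rw [eval_jacobianDet] at hne
    have h1 := linearIndependent_of_det_mul_ne_zero hne
    let y : Fin _ → conormalSpace Z v := fun i => ⟨gradient v (f i), f i, hf i, rfl⟩
    have hy : LinearIndependent ℂ y :=
      LinearIndependent.of_comp (conormalSpace Z v).subtype h1
    have h2 := hy.fintype_card_le_finrank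
    rw [Fintype.card_fin] at h2
    have h3 := finrank_conormalSpace_add_affineDim_le hZ hv
    rw [isSmoothAt_iff] at hs ⊢
    omega

end Tangent

/-! ### Homogeneity -/

section Homogeneous

variable {ι : Type}

theorem eval_smul_of_isHomogeneous {f : MvPolynomial ι ℂ} {d : ℕ} (hf : f.IsHomogeneous d)
    (t : ℂ) (v : ι → ℂ) : eval (t • v) f = t ^ d * eval v f := by
  rw [eval_eq, eval_eq, Finset.mul_sum]
  refine Finset.sum_congr rfl fun m hm => ?_
  have h1 := hf (mem_support_iff.mp hm)
  rw [Finsupp.weight_apply, Finsupp.sum] at h1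
  simp only [Pi.one_apply, smul_eq_mul, mul_one] at h1
  simp only [Pi.smul_apply, smul_eq_mul, mul_pow, Finset.prod_mul_distrib]
  rw [Finset.prod_pow_eq_pow_sum, h1]
  ring

theorem eval_smul_eq_sum (t : ℂ) (v : ι → ℂ) (f : MvPolynomial ι ℂ) :
    eval (t • v) f
      = ∑ d ∈ Finset.range (f.totalDegree + 1), t ^ d * eval v (homogeneousComponent d f) := by
  conv_lhs => rw [← sum_homogeneousComponent f]
  rw [map_sum]
  refine Finset.sum_congr rfl fun d _ => ?_
  exact eval_smul_of_isHomogeneous (homogeneousComponent_isHomogeneous d f) t v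

/-- The ideal of a cone is homogeneous. -/
theorem homogeneousComponent_mem_ideal {Z : Set (PSpace ι)} {f : MvPolynomial ι ℂ}
    (hf : f ∈ ideal Z) (d : ℕ) : homogeneousComponent d f ∈ ideal Z := by
  rw [mem_ideal] at hf ⊢
  intro v hv
  rcases lt_or_ge f.totalDegree d with hd | hd
  · rw [homogeneousComponent_eq_zero _ _ hd, map_zero]
  let p : Polynomial ℂ := ∑ d ∈ Finset.range (f.totalDegree + 1),
    Polynomial.monomial d (eval v (homogeneousComponent d f))
  have hp : p = 0 := by
    refine Polynomial.eq_zero_of_infinite_isRoot p ?_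
    refine Set.Infinite.mono ?_ (Set.finite_singleton (0 : ℂ)).infinite_compl
    intro t ht
    have h := hf _ (smul_mem_cone hv ht)
    rw [eval_smul_eq_sum] at h
    change Polynomial.eval t p = 0
    rw [← h]
    simp only [p, Polynomial.eval_finsetSum, Polynomial.eval_monomial, mul_comm]
  have h := congrArg (fun q => Polynomial.coeff q d) hp
  simp only [p, Polynomial.finsetSum_coeff, Polynomial.coeff_monomial] at h
  rw [Finset.sum_ite_eq' (Finset.range (f.totalDegree + 1)) d,
    if_pos (Finset.mem_range.mpr (by omega))] at h
  simpa using h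

/-- Euler's relation, applied to the homogeneous components. -/
theorem sum_mul_pderiv_mem_ideal [Fintype ι] {Z : Set (PSpace ι)} {f : MvPolynomial ι ℂ}
    (hf : f ∈ ideal Z) : ∑ j, X j * pderiv j f ∈ ideal Z := by
  have h : ∑ j, X j * pderiv j f
      = ∑ d ∈ Finset.range (f.totalDegree + 1), d • homogeneousComponent d f := by
    conv_lhs => rw [← sum_homogeneousComponent f]
    simp only [map_sum, Finset.mul_sum]
    rw [Finset.sum_comm]
    exact Finset.sum_congr rfl fun d _ =>
      (homogeneousComponent_isHomogeneous d f).sum_X_mul_pderiv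
  rw [h]
  exact Ideal.sum_mem _ fun d _ => nsmul_mem (homogeneousComponent_mem_ideal hf d) _

/-- A generator divides its homogeneous components, one of which is not zero. -/
theorem IsHypersurfaceWith.isHomogeneous {Z : Set (PSpace ι)} {φ : MvPolynomial ι ℂ}
    (h : IsHypersurfaceWith Z φ) : φ.IsHomogeneous φ.totalDegree := by
  obtain ⟨h0, -, hI⟩ := h
  obtain ⟨d, hd⟩ : ∃ d, homogeneousComponent d φ ≠ 0 := by
    by_contra! hcon
    apply h0
    rw [← sum_homogeneousComponent φ]
    exact Finset.sum_eq_zero fun d _ => hcon d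
  have hφ : φ ∈ ideal Z := by rw [hI]; exact Ideal.mem_span_singleton_self φ
  have hm := homogeneousComponent_mem_ideal hφ d
  rw [hI, Ideal.mem_span_singleton] at hm
  obtain ⟨q, hq⟩ := hm
  have hq0 : q ≠ 0 := by rintro rfl; exact hd (by rw [hq, mul_zero])
  have h1 := (homogeneousComponent_isHomogeneous d φ).totalDegree hd
  have h2 : d ≤ φ.totalDegree := by
    by_contra! hlt
    exact hd (homogeneousComponent_eq_zero _ _ hlt)
  rw [hq, totalDegree_mul_of_isDomain h0 hq0] at h1
  have hqd : q.totalDegree = 0 := by omega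
  have hdd : d = φ.totalDegree := by omega
  obtain ⟨c, hc⟩ : ∃ c, q = C c := ⟨_, totalDegree_eq_zero_iff_eq_C.mp hqd⟩
  have hc0 : c ≠ 0 := by rintro rfl; exact hq0 (by rw [hc, map_zero])
  have h3 : φ = C c⁻¹ * homogeneousComponent d φ := by
    rw [hq, hc, mul_comm φ, ← mul_assoc, ← C_mul, inv_mul_cancel₀ hc0, C_1, one_mul]
  rw [← hdd, h3]
  exact (homogeneousComponent_isHomogeneous d φ).C_mul _

theorem IsHypersurfaceWith.ideal_ne_top {Z : Set (PSpace ι)} {φ : MvPolynomial ι ℂ}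
    (h : IsHypersurfaceWith Z φ) : ideal Z ≠ ⊤ := by
  rw [h.2.2, Ne, Ideal.span_singleton_eq_top]
  exact h.2.1

end Homogeneous

/-! ### Linear components of dual hypersurfaces -/

section LinearForm

variable {ι : Type} [Fintype ι]

/-- The linear form with coefficients `e`. -/
def linForm (e : ι → ℂ) : MvPolynomial ι ℂ := ∑ j, C (e j) * X j

theorem eval_linForm (e v : ι → ℂ) : eval v (linForm e) = e ⬝ᵥ v := by
  simp [linForm, dotProduct]

open Classical in
/-- The point of the hyperplane `e` whose coordinates, except for that with index `a`, are those
of `v`. -/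
def project (e : ι → ℂ) (a : ι) (v : ι → ℂ) : ι → ℂ :=
  Function.update v a (-(e a)⁻¹ * ∑ j ∈ Finset.univ.erase a, e j * v j)

theorem dotProduct_project {e : ι → ℂ} {a : ι} (ha : e a ≠ 0) (v : ι → ℂ) :
    e ⬝ᵥ project e a v = 0 := by
  classical
  rw [dotProduct, ← Finset.add_sum_erase _ _ (Finset.mem_univ a)]
  have h : ∑ j ∈ Finset.univ.erase a, e j * project e a v j
      = ∑ j ∈ Finset.univ.erase a, e j * v j :=
    Finset.sum_congr rfl fun j hj => by
      rw [project, Function.update_of_ne (Finset.ne_of_mem_erase hj)]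
  rw [h, project, Function.update_self]
  rw [neg_mul, mul_neg, mul_inv_cancel_left₀ ha, neg_add_cancel]

theorem project_of_ne (e : ι → ℂ) {a j : ι} (h : j ≠ a) (v : ι → ℂ) :
    project e a v j = v j := by
  classical
  rw [project, Function.update_of_ne h]

/-- The substitution `s` lands in the hyperplane, so it kills `φ`, and it is the identity modulo
the equation of the hyperplane. -/
theorem linForm_dvd {e : ι → ℂ} {a : ι} (ha : e a ≠ 0) {φ : MvPolynomial ι ℂ}
    (hφ : ∀ v, e ⬝ᵥ v = 0 → eval v φ = 0) : linForm e ∣ φ := by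
  classical
  let s : ι → MvPolynomial ι ℂ := fun j =>
    if j = a then X a - C (e a)⁻¹ * linForm e else X j
  have hs : aeval s φ = 0 := by
    refine MvPolynomial.funext fun v => ?_
    rw [← eval_eval_eq_eval_aeval, map_zero]
    apply hφ
    have : ∀ j, e j * eval v (s j) = e j * v j - if j = a then e ⬝ᵥ v else 0 := by
      intro j
      by_cases hj : j = a
      · subst hj
        simp only [s, if_true, map_sub, map_mul, eval_X, eval_C, eval_linForm]
        field_simp
      · simp [s, hj]
    simp only [dotProduct, this, Finset.sum_sub_distrib]
    rw [Finset.sum_ite_eq' Finset.univ a]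
    simp
  let π := Ideal.Quotient.mkₐ ℂ (Ideal.span {linForm e})
  have h0 : π (linForm e) = 0 :=
    Ideal.Quotient.eq_zero_iff_mem.mpr (Ideal.mem_span_singleton_self _)
  have h1 : π.comp (aeval s) = π := by
    ext j
    by_cases hj : j = a
    · subst hj
      simp only [AlgHom.comp_apply, aeval_X, s, if_true, map_sub, map_mul, h0, mul_zero, sub_zero]
    · simp [s, hj]
  have h2 : π φ = 0 := by rw [← h1, AlgHom.comp_apply, hs, map_zero]
  exact Ideal.mem_span_singleton.mp (Ideal.Quotient.eq_zero_iff_mem.mp h2)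

end LinearForm

section Dual

variable {ι : Type} [Fintype ι]

theorem mem_ideal_dualVariety {Z : Set (PSpace ι)} {q : MvPolynomial ι ℂ} :
    q ∈ ideal (dualVariety Z) ↔
      ∀ v ∈ cone Z, IsSmoothAt Z v → ∀ h ∈ conormalSpace Z v, h ≠ 0 → eval h q = 0 := by
  rw [dualVariety, ideal_zariskiClosure, mem_ideal]
  constructor
  · intro H v hv hs h hh h0
    refine H h ⟨h0, v, hv, hs, ?_⟩
    rw [← mem_conormalSpace_iff]
    obtain ⟨a, ha⟩ := Projectivization.exists_smul_eq_mk_rep ℂ h h0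
    rw [← ha]
    exact Submodule.smul_mem _ (a : ℂ) hh
  · rintro H h ⟨h0, v, hv, hs, hT⟩
    refine H v hv hs h ?_ h0
    rw [← mem_conormalSpace_iff] at hT
    obtain ⟨t, -, ht⟩ := exists_smul_rep h0
    rw [ht]
    exact Submodule.smul_mem _ t hT

/-- If the dual variety of an irreducible variety contains the hyperplane of all hyperplanes
through the point `e`, then the variety is the point `e`. -/
theorem exists_eq_smul_of_dualVariety {Z : Set (PSpace ι)} (hZ : (ideal Z).IsPrime)
    {φ : MvPolynomial ι ℂ} (hφ : IsHypersurfaceWith (dualVariety Z) φ) {e : ι → ℂ} (he : e ≠ 0)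
    (hφe : ∀ h, e ⬝ᵥ h = 0 → eval h φ = 0) {v : ι → ℂ} (hv : v ∈ cone Z) :
    ∃ s : ℂ, v = s • e := by
  classical
  obtain ⟨a, ha⟩ := Function.ne_iff.mp he
  rw [Pi.zero_apply] at ha
  obtain ⟨q, hq⟩ := linForm_dvd ha hφe
  have hφ0 := hφ.1
  have hdual := hφ.ideal_ne_top
  -- The universal conormal vector `G`, a combination of the gradients of generators of the ideal
  -- with independent coefficients: its coordinates are polynomials over the coordinate ring.
  obtain ⟨S, hS⟩ : (ideal Z).FG := IsNoetherian.noetherian _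
  obtain ⟨r, f, hf⟩ : ∃ (r : ℕ) (f : Fin r → MvPolynomial ι ℂ),
      Ideal.span (Set.range f) = ideal Z :=
    ⟨S.card, fun i => (S.equivFin.symm i : MvPolynomial ι ℂ), by
      rw [← hS]
      congr 1
      ext p
      constructor
      · rintro ⟨i, rfl⟩; exact (S.equivFin.symm i).2
      · intro hp; exact ⟨S.equivFin ⟨p, hp⟩, by simp⟩⟩
  have hfm : ∀ i, f i ∈ ideal Z := fun i => by rw [← hf]; exact Ideal.subset_span ⟨i, rfl⟩
  let A := MvPolynomial ι ℂ ⧸ ideal Z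
  let B := MvPolynomial (Fin r) A
  let L := FractionRing B
  let mk : MvPolynomial ι ℂ →ₐ[ℂ] A := Ideal.Quotient.mkₐ ℂ (ideal Z)
  have hmk : ∀ p, mk p = 0 ↔ p ∈ ideal Z := fun p => Ideal.Quotient.eq_zero_iff_mem
  have hLinj : Function.Injective (algebraMap B L) := IsFractionRing.injective B L
  let τ : MvPolynomial ι ℂ →ₐ[ℂ] B := (IsScalarTower.toAlgHom ℂ A B).comp mk
  have hτ : ∀ p, τ p = 0 ↔ p ∈ ideal Z := by
    intro p
    rw [← hmk]
    exact map_eq_zero_iff (C : A →+* B) (C_injective _ _)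
  let G : ι → B := fun j => ∑ i, X i * τ (pderiv j (f i))
  -- evaluation at a point of the cone and at coefficients `c`
  let ev : ∀ w ∈ cone Z, (A →ₐ[ℂ] ℂ) := fun w hw =>
    Ideal.Quotient.liftₐ (ideal Z) (aeval w) fun p hp => by
      rw [aeval_eq_eval]; exact mem_ideal.mp hp w hw
  have hev : ∀ w (hw : w ∈ cone Z) p, ev w hw (mk p) = eval w p := by
    intro w hw p
    rw [← aeval_eq_eval]
    rfl
  let ε : ∀ w ∈ cone Z, (Fin r → ℂ) → (B →ₐ[ℂ] ℂ) := fun w hw c => aevalTower (ev w hw) c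
  have hετ : ∀ w (hw : w ∈ cone Z) c p, ε w hw c (τ p) = eval w p := by
    intro w hw c p
    rw [← hev w hw]
    exact aevalTower_C _ _ _
  have hεX : ∀ w (hw : w ∈ cone Z) c i, ε w hw c (X i) = c i := by
    intro w hw c i
    exact aevalTower_X _ _ _
  have hεG : ∀ w (hw : w ∈ cone Z) c j,
      ε w hw c (G j) = ∑ i, c i * gradient w (f i) j := by
    intro w hw c j
    simp only [G, map_sum, map_mul, hετ, hεX]
    rfl
  have hε0 : ∀ b : B, (∀ w (hw : w ∈ cone Z) c, ε w hw c b = 0) → b = 0 := by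
    intro b hb
    ext m
    rw [coeff_zero]
    obtain ⟨p, hp⟩ := Ideal.Quotient.mk_surjective (coeff m b)
    rw [← hp, Ideal.Quotient.eq_zero_iff_mem, mem_ideal]
    intro w hw
    have h1 : map (ev w hw : A →+* ℂ) b = 0 := by
      refine MvPolynomial.funext fun c => ?_
      rw [map_zero, eval_map]
      exact hb w hw c
    have h2 := congrArg (coeff m) h1
    rw [coeff_map, ← hp, coeff_zero] at h2
    rw [← hev w hw]
    exact h2
  have hεq : ∀ w (hw : w ∈ cone Z) c p,
      ε w hw c (aeval G p) = eval (∑ i, c i • gradient w (f i)) p := by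
    intro w hw c p
    rw [← AlgHom.comp_apply, comp_aeval, aeval_eq_eval]
    congr 2
    ext j
    rw [hεG w hw]
    simp
  have hspan : ∀ w ∈ cone Z, ∀ h ∈ conormalSpace Z w,
      ∃ c : Fin r → ℂ, h = ∑ i, c i • gradient w (f i) := by
    rintro w hw _ ⟨p, hp, rfl⟩
    have hp' : p ∈ Ideal.span (Set.range f) := by rw [hf]; exact hp
    obtain ⟨c, rfl⟩ := Ideal.mem_span_range_iff_exists_fun.mp hp'
    refine ⟨fun i => eval w (c i), ?_⟩
    ext j
    have hz : ∀ i, eval w (f i) = 0 := fun i => mem_ideal.mp (hfm i) w hw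
    simp [gradient, Derivation.leibniz, hz]
  -- the relations among the coordinates of the universal conormal vector
  have hker1 : ∀ p, aeval G p = 0 → p ∈ ideal (dualVariety Z) := by
    intro p hp
    rw [mem_ideal_dualVariety]
    intro w hw _ h hh _
    obtain ⟨c, rfl⟩ := hspan w hw h hh
    rw [← hεq w hw, hp, map_zero]
  have hG0 : ∃ j, G j ≠ 0 := by
    by_contra! hcon
    obtain ⟨h, hh⟩ := cone_nonempty_of_ideal_ne_top hdual
    apply ne_zero_of_mem_cone hh
    ext j
    have := mem_ideal.mp (hker1 (X j) (by rw [aeval_X, hcon])) h hh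
    simpa using this
  have hsm : ∃ w ∈ cone Z, IsSmoothAt Z w := by
    by_contra! hcon
    apply hdual
    rw [Ideal.eq_top_iff_one, mem_ideal_dualVariety]
    intro w hw hs
    exact absurd hs (hcon w hw)
  have hker2 : ∀ p ∈ ideal (dualVariety Z), aeval G p = 0 := by
    intro p hp
    obtain ⟨w₀, hw₀, hs₀⟩ := hsm
    obtain ⟨Δ, hΔ, hsmooth⟩ := exists_smooth_of_eval_ne_zero hZ hw₀ hs₀
    obtain ⟨j, hj⟩ := hG0
    have h0 : τ Δ * G j * aeval G p = 0 := by
      refine hε0 _ fun w hw c => ?_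
      rw [map_mul, map_mul, hετ w hw, hεq w hw, hεG w hw]
      by_cases h1 : eval w Δ = 0
      · rw [h1, zero_mul, zero_mul]
      by_cases h2 : ∑ i, c i • gradient w (f i) = 0
      · have := congrFun h2 j
        simp only [Finset.sum_apply, Pi.smul_apply, smul_eq_mul, Pi.zero_apply] at this
        rw [this, mul_zero, zero_mul]
      · rw [mem_ideal_dualVariety.mp hp w hw (hsmooth w hw h1) _ ?_ h2, mul_zero]
        exact Submodule.sum_mem _ fun i _ => Submodule.smul_mem _ _ ⟨f i, hfm i, rfl⟩
    rcases mul_eq_zero.mp h0 with h1 | h1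
    · rcases mul_eq_zero.mp h1 with h2 | h2
      · exact absurd ((hτ _).mp h2) hΔ
      · exact absurd h2 hj
    · exact h1
  -- so the ideal of the dual variety is prime, and the linear factor of `φ` generates it
  have hφI : ideal (dualVariety Z) = Ideal.span {φ} := hφ.2.2
  have hℓ : aeval G (linForm e) = 0 := by
    have h1 := hker2 φ (by rw [hφI]; exact Ideal.mem_span_singleton_self φ)
    rw [hq, map_mul] at h1
    refine (mul_eq_zero.mp h1).resolve_right fun h2 => ?_
    have h3 := hker1 q h2
    rw [hφI, Ideal.mem_span_singleton] at h3
    obtain ⟨u, hu⟩ := h3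
    have h4 : linForm e * u = 1 := by
      apply mul_left_cancel₀ hφ0
      calc φ * (linForm e * u) = linForm e * (φ * u) := by ring
        _ = φ * 1 := by rw [← hu, ← hq, mul_one]
    have h5 := congrArg (eval (0 : ι → ℂ)) h4
    rw [map_mul, eval_linForm, dotProduct_zero, zero_mul, map_one] at h5
    exact zero_ne_one h5
  -- the coordinates other than the one with index `a` are algebraically independent
  have hind : AlgebraicIndependent ℂ fun j : {j // j ≠ a} => G j.1 := by
    rw [algebraicIndependent_iff]
    intro P hP
    have h1 : aeval G (rename Subtype.val P) = 0 := by
      rw [aeval_rename]; exact hP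
    have h2 := hker1 _ h1
    rw [hφI, Ideal.mem_span_singleton] at h2
    have h3 : linForm e ∣ rename Subtype.val P := (Dvd.intro _ hq.symm).trans h2
    obtain ⟨u, hu⟩ := h3
    refine MvPolynomial.funext fun y => ?_
    have h4 := congrArg (eval (project e a fun j => if hj : j ≠ a then y ⟨j, hj⟩ else 0)) hu
    rw [map_mul, eval_linForm, dotProduct_project ha, zero_mul, eval_rename] at h4
    rw [map_zero, ← h4]
    congr 2
    ext j
    rw [Function.comp_apply, project_of_ne e j.2, dif_pos j.2]
  let x : ι → L := fun j => algebraMap B L (τ (X j))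
  have hx : ∀ p, aeval x p = algebraMap B L (τ p) := by
    intro p
    have : aeval x = (IsScalarTower.toAlgHom ℂ B L).comp τ := by
      ext j
      simp [x]
    rw [this]
    rfl
  have hGx : ∀ j, ∑ i, algebraMap B L (X i) * aeval x (pderiv j (f i)) = algebraMap B L (G j) := by
    intro j
    simp only [hx, G, map_sum, map_mul]
  have hcore := mul_eq_mul_of_conormal x (fun i => algebraMap B L (X i)) f
    (fun i => by rw [hx, (hτ _).mpr (hfm i), map_zero])
    (fun i => by
      have h1 := (hτ _).mpr (sum_mul_pderiv_mem_ideal (hfm i))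
      rw [← map_zero (algebraMap B L), ← h1]
      simp only [hx, x, map_sum, map_mul])
    e a ha
    (by
      simp only [hGx]
      have h1 := congrArg (algebraMap B L) hℓ
      rw [map_zero] at h1
      rw [← h1]
      simp only [linForm, map_sum, map_mul, aeval_X, algHom_C, ← IsScalarTower.algebraMap_apply])
    (by
      simp only [hGx]
      exact hind.map' (f := IsScalarTower.toAlgHom ℂ B L) hLinj)
  refine ⟨v a * (e a)⁻¹, ?_⟩
  ext j
  have h1 : τ (C (e a) * X j - C (e j) * X a) = 0 := by
    apply hLinj
    rw [map_zero, map_sub, map_sub, sub_eq_zero]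
    simpa only [map_mul, algHom_C, ← IsScalarTower.algebraMap_apply] using hcore j
  have h2 := mem_ideal.mp ((hτ _).mp h1) v hv
  simp only [map_sub, map_mul, eval_C, eval_X] at h2
  rw [Pi.smul_apply, smul_eq_mul]
  field_simp
  linear_combination h2

end Dual

/-! ### Projections and the degrees of the dual hypersurfaces -/

section Projection

variable {k : ℕ} {M : Matrix (Fin (k + 2)) (Fin (k + 3)) ℂ} {X : Set (PSpace (Fin (k + 3)))}

/-- Composition of a polynomial with the linear map with matrix `M`. -/
def linSubst {m n : ℕ} (M : Matrix (Fin m) (Fin n) ℂ) :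
    MvPolynomial (Fin m) ℂ →ₐ[ℂ] MvPolynomial (Fin n) ℂ :=
  aeval fun i => linForm (M i)

theorem eval_linSubst {m n : ℕ} (M : Matrix (Fin m) (Fin n) ℂ) (v : Fin n → ℂ)
    (f : MvPolynomial (Fin m) ℂ) : eval v (linSubst M f) = eval (M.mulVec v) f := by
  rw [linSubst, ← eval_eval_eq_eval_aeval]
  congr 2
  ext i
  rw [eval_linForm]
  rfl

theorem isHomogeneous_linForm {ι : Type} [Fintype ι] (e : ι → ℂ) :
    (linForm e).IsHomogeneous 1 :=
  IsHomogeneous.sum _ _ _ fun j _ => (isHomogeneous_X ℂ j).C_mul _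

theorem isHomogeneous_linSubst {m n : ℕ} (A : Matrix (Fin m) (Fin n) ℂ)
    {φ : MvPolynomial (Fin m) ℂ} {d : ℕ} (hφ : φ.IsHomogeneous d) :
    (linSubst A φ).IsHomogeneous d := by
  have h := hφ.aeval (fun i => linForm (A i)) fun i => isHomogeneous_linForm (A i)
  rwa [one_mul] at h

theorem pderiv_linForm {ι : Type} [Fintype ι] (e : ι → ℂ) (j : ι) :
    pderiv j (linForm e) = C (e j) := by
  classical
  rw [linForm, map_sum, Finset.sum_eq_single j]
  · simp
  · intro i _ hi
    simp [pderiv_X, hi]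
  · simp

theorem pderiv_linSubst {m n : ℕ} (M : Matrix (Fin m) (Fin n) ℂ) (f : MvPolynomial (Fin m) ℂ)
    (j : Fin n) : pderiv j (linSubst M f) = ∑ i, linSubst M (pderiv i f) * C (M i j) := by
  induction f using MvPolynomial.induction_on with
  | C a => simp [linSubst]
  | add p q hp hq => simp only [map_add, hp, hq, add_mul, Finset.sum_add_distrib]
  | mul_X p i hp =>
    have hX : linSubst M (X i) = linForm (M i) := aeval_X _ _
    simp only [map_mul, Derivation.leibniz, hp, smul_eq_mul, map_add, hX, pderiv_linForm, pderiv_X,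
      add_mul, Finset.sum_add_distrib, Finset.mul_sum]
    congr 1
    · rw [Finset.sum_eq_single i]
      · simp
      · intro b _ hb
        simp [hb.symm]
      · simp
    · exact Finset.sum_congr rfl fun l _ => by ring

theorem gradient_linSubst {m n : ℕ} (M : Matrix (Fin m) (Fin n) ℂ) (v : Fin n → ℂ)
    (f : MvPolynomial (Fin m) ℂ) :
    gradient v (linSubst M f) = M.transpose.mulVec (gradient (M.mulVec v) f) := by
  ext j
  change eval v (pderiv j (linSubst M f)) = ∑ i, M i j * eval (M.mulVec v) (pderiv i f)
  rw [pderiv_linSubst, map_sum]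
  refine Finset.sum_congr rfl fun i _ => ?_
  rw [map_mul, eval_linSubst, eval_C, mul_comm]

theorem mem_cone_projection (hO : ∀ v ∈ cone X, M.mulVec v ≠ 0) {w : Fin (k + 2) → ℂ} :
    w ∈ cone (projection M X) ↔ ∃ v ∈ cone X, M.mulVec v = w := by
  constructor
  · rintro ⟨hw, v, hv, hne, h⟩
    obtain ⟨t, ht⟩ := (Projectivization.mk_eq_mk_iff' ℂ _ _ hw hne).mp h
    have ht0 : t ≠ 0 := by
      rintro rfl
      rw [zero_smul] at ht
      exact hw ht.symm
    exact ⟨t • v, smul_mem_cone hv ht0, by rw [Matrix.mulVec_smul, ht]⟩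
  · rintro ⟨v, hv, rfl⟩
    exact ⟨hO v hv, v, hv, hO v hv, rfl⟩

theorem mem_ideal_projection (hO : ∀ v ∈ cone X, M.mulVec v ≠ 0)
    {f : MvPolynomial (Fin (k + 2)) ℂ} :
    f ∈ ideal (projection M X) ↔ linSubst M f ∈ ideal X := by
  rw [mem_ideal, mem_ideal]
  simp only [mem_cone_projection hO, eval_linSubst]
  constructor
  · intro h v hv
    exact h _ ⟨v, hv, rfl⟩
  · rintro h _ ⟨v, hv, rfl⟩
    exact h v hv

theorem isPrime_ideal_projection (hO : ∀ v ∈ cone X, M.mulVec v ≠ 0) (hX : (ideal X).IsPrime) :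
    (ideal (projection M X)).IsPrime := by
  have : ideal (projection M X) = (ideal X).comap (linSubst M) := by
    ext f
    rw [mem_ideal_projection hO, Ideal.mem_comap]
  rw [this]
  exact Ideal.comap_isPrime _ _

theorem mulVec_transpose_injective (hM : M.rank = k + 2) :
    Function.Injective M.transpose.mulVec := by
  rw [Matrix.mulVec_injective_iff]
  have h : M.transpose.rank = k + 2 := by rw [Matrix.rank_transpose, hM]
  rw [linearIndependent_iff_card_eq_finrank_span]
  rw [Matrix.rank_eq_finrank_span_cols] at h
  rw [Set.finrank, h, Fintype.card_fin]

theorem exists_kernel_of_rank (M : Matrix (Fin (k + 2)) (Fin (k + 3)) ℂ) :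
    ∃ O : Fin (k + 3) → ℂ, O ≠ 0 ∧ M.mulVec O = 0 := by
  have h := LinearMap.ker_ne_bot_of_finrank_lt (f := M.mulVecLin) (by simp)
  obtain ⟨O, hO, h0⟩ := Submodule.exists_mem_ne_zero_of_ne_bot h
  exact ⟨O, h0, hO⟩

/-- The hyperplanes through the centre of a projection are the preimages of hyperplanes. -/
theorem exists_transpose_mulVec_eq (hM : M.rank = k + 2) {O : Fin (k + 3) → ℂ} (hO0 : O ≠ 0)
    (hO : M.mulVec O = 0) {h : Fin (k + 3) → ℂ} (hh : O ⬝ᵥ h = 0) :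
    ∃ h', M.transpose.mulVec h' = h := by
  let T : (Fin (k + 3) → ℂ) →ₗ[ℂ] ℂ := dotProductEquiv ℂ _ O
  have h1 : LinearMap.range M.transpose.mulVecLin ≤ LinearMap.ker T := by
    rintro _ ⟨y, rfl⟩
    change O ⬝ᵥ M.transpose.mulVec y = 0
    rw [Matrix.dotProduct_mulVec, Matrix.vecMul_transpose, hO, zero_dotProduct]
  have h2 : Module.finrank ℂ (LinearMap.range M.transpose.mulVecLin) = k + 2 := by
    rw [LinearMap.finrank_range_of_inj (mulVec_transpose_injective hM)]
    simp
  have hT : T ≠ 0 := by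
    intro hT
    exact hO0 ((dotProductEquiv ℂ _).map_eq_zero_iff.mp hT)
  have h3 : Module.finrank ℂ (LinearMap.ker T) = k + 2 := by
    have := Module.Dual.finrank_ker_add_one_of_ne_zero hT
    simp only [Module.finrank_fintype_fun_eq_card, Fintype.card_fin] at this
    omega
  have h4 := Submodule.eq_of_le_of_finrank_eq h1 (by rw [h2, h3])
  have h5 : h ∈ LinearMap.ker T := hh
  rw [← h4] at h5
  exact h5

/-- Not all hyperplanes through a point `e` belong to the dual of a projection: otherwise the
projection would be the point `e`, and `X` would lie in a hyperplane. -/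
theorem exists_eval_ne_zero_of_projection (hX : (ideal X).IsPrime) (hnd : Nondegenerate X)
    (hM : M.rank = k + 2) (hO : ∀ v ∈ cone X, M.mulVec v ≠ 0) {φ : MvPolynomial (Fin (k + 2)) ℂ}
    (hφ : IsHypersurfaceWith (dualVariety (projection M X)) φ) {e : Fin (k + 2) → ℂ}
    (he : e ≠ 0) : ∃ h, e ⬝ᵥ h = 0 ∧ eval h φ ≠ 0 := by
  by_contra! hcon
  obtain ⟨h', h0, hh'⟩ : ∃ h' : Fin (k + 2) → ℂ, h' ≠ 0 ∧ h' ⬝ᵥ e = 0 := by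
    obtain ⟨a, ha⟩ := Function.ne_iff.mp he
    obtain ⟨b, hb⟩ := exists_ne a
    refine ⟨project e a (Pi.single b 1), fun hc => ?_, ?_⟩
    · have := congrFun hc b
      rw [project_of_ne e hb] at this
      simp at this
    · rw [dotProduct_comm]
      exact dotProduct_project ha _
  apply h0
  apply mulVec_transpose_injective hM
  rw [Matrix.mulVec_zero]
  apply hnd
  intro v hv
  obtain ⟨s, hs⟩ := exists_eq_smul_of_dualVariety (isPrime_ideal_projection hO hX) hφ he hcon
    ((mem_cone_projection hO).mpr ⟨v, hv, rfl⟩)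
  rw [Matrix.mulVec_transpose, ← Matrix.dotProduct_mulVec, hs, dotProduct_smul, hh', smul_zero]

theorem linSubst_transpose_mem_ideal {n : ℕ} (hX : IsSmoothVariety X n)
    (hM : M.rank = k + 2) (hO : ∀ v ∈ cone X, M.mulVec v ≠ 0)
    {ψ : MvPolynomial (Fin (k + 3)) ℂ} (hψ : ψ ∈ ideal (dualVariety X)) :
    linSubst M.transpose ψ ∈ ideal (dualVariety (projection M X)) := by
  rw [mem_ideal_dualVariety] at hψ ⊢
  intro w hw _ h hh h0
  obtain ⟨v, hv, rfl⟩ := (mem_cone_projection hO).mp hw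
  rw [eval_linSubst]
  refine hψ v hv (hX.smooth v hv) _ ?_ ?_
  · obtain ⟨f, hf, rfl⟩ := hh
    refine ⟨linSubst M f, (mem_ideal_projection hO).mp hf, ?_⟩
    exact gradient_linSubst M v f
  · intro hc
    rw [← Matrix.mulVec_zero M.transpose] at hc
    exact h0 (mulVec_transpose_injective hM hc)

/-- The class of a projection is at most the class of the variety: the dual of the projection lies
in a hyperplane section of the dual of `X`, by the hyperplane of the hyperplanes through the
centre. This section is proper, as otherwise `X` would be the centre. -/
theorem totalDegree_le_of_projection {n : ℕ} (hX : IsSmoothVariety X n)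
    (hM : M.rank = k + 2) (hO : ∀ v ∈ cone X, M.mulVec v ≠ 0)
    {ψ : MvPolynomial (Fin (k + 3)) ℂ} (hψ : IsHypersurfaceWith (dualVariety X) ψ)
    {φ : MvPolynomial (Fin (k + 2)) ℂ}
    (hφ : IsHypersurfaceWith (dualVariety (projection M X)) φ) :
    φ.totalDegree ≤ ψ.totalDegree := by
  have hψI : ψ ∈ ideal (dualVariety X) := by
    rw [hψ.2.2]; exact Ideal.mem_span_singleton_self ψ
  have h1 := linSubst_transpose_mem_ideal hX hM hO hψI
  rw [hφ.2.2, Ideal.mem_span_singleton] at h1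
  have hne : linSubst M.transpose ψ ≠ 0 := by
    intro hc
    obtain ⟨O, hO0, hMO⟩ := exists_kernel_of_rank M
    obtain ⟨v, hv⟩ := cone_nonempty_of_ideal_ne_top hX.irreducible.ne_top
    obtain ⟨s, rfl⟩ := exists_eq_smul_of_dualVariety hX.irreducible hψ hO0 (fun h hh => by
      obtain ⟨h', rfl⟩ := exists_transpose_mulVec_eq hM hO0 hMO hh
      rw [← eval_linSubst, hc, map_zero]) hv
    exact hO _ hv (by rw [Matrix.mulVec_smul, hMO, smul_zero])
  obtain ⟨u, hu⟩ := h1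
  have hu0 : u ≠ 0 := by rintro rfl; exact hne (by rw [hu, mul_zero])
  have h2 := (isHomogeneous_linSubst M.transpose hψ.isHomogeneous).totalDegree_le
  rw [hu, totalDegree_mul_of_isDomain hφ.1 hu0] at h2
  omega

/-- A point of the dual projective line is the only hyperplane through some point of the
projective line, so for `k = 0` a nonempty dual would contain all hyperplanes through a point. -/
theorem ne_zero_of_projection (hX : (ideal X).IsPrime) (hnd : Nondegenerate X)
    (hM : M.rank = k + 2) (hO : ∀ v ∈ cone X, M.mulVec v ≠ 0) {φ : MvPolynomial (Fin (k + 2)) ℂ}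
    (hφ : IsHypersurfaceWith (dualVariety (projection M X)) φ) : k ≠ 0 := by
  rintro rfl
  obtain ⟨h, hh⟩ := cone_nonempty_of_ideal_ne_top hφ.ideal_ne_top
  have hφh : eval h φ = 0 := mem_ideal.mp
    (by rw [hφ.2.2]; exact Ideal.mem_span_singleton_self φ) h hh
  have h0 := ne_zero_of_mem_cone hh
  have he : (![-h 1, h 0] : Fin 2 → ℂ) ≠ 0 := by
    intro hc
    apply h0
    have h1 := congrFun hc 0
    have h2 := congrFun hc 1
    ext i
    fin_cases i
    · simpa using h2
    · simpa using h1
  obtain ⟨h', hh', hne⟩ := exists_eval_ne_zero_of_projection hX hnd hM hO hφ he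
  apply hne
  have h3 : -h 1 * h' 0 + h 0 * h' 1 = 0 := by
    simpa [dotProduct, Fin.sum_univ_two] using hh'
  obtain ⟨s, rfl⟩ : ∃ s : ℂ, h' = s • h := by
    by_cases hz : h 0 = 0
    · have hz1 : h 1 ≠ 0 := by
        intro hc
        apply h0
        ext i
        fin_cases i
        · exact hz
        · exact hc
      refine ⟨h' 1 / h 1, ?_⟩
      ext i
      fin_cases i
      · change h' 0 = h' 1 / h 1 * h 0
        field_simp
        linear_combination -h3
      · change h' 1 = h' 1 / h 1 * h 1
        field_simp
    · refine ⟨h' 0 / h 0, ?_⟩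
      ext i
      fin_cases i
      · change h' 0 = h' 0 / h 0 * h 0
        field_simp
      · change h' 1 = h' 0 / h 0 * h 1
        field_simp
        linear_combination h3
  rw [eval_smul_of_isHomogeneous hφ.isHomogeneous, hφh, mul_zero]

end Projection

/-! ### Extensors and joins -/

section Extensor

variable {k : ℕ}

/-- The Plücker index that omits `p` and `p.succAbove q`. -/
def omitTwo (p : Fin (k + 2)) (q : Fin (k + 1)) : Plu k :=
  ⟨({p, p.succAbove q} : Finset (Fin (k + 2)))ᶜ, by
    rw [Finset.card_compl, Finset.card_pair (Fin.succAbove_ne p q).symm, Fintype.card_fin]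
    omega⟩

theorem mem_omitTwo {p : Fin (k + 2)} {q : Fin (k + 1)} {x : Fin (k + 2)} :
    x ∈ (omitTwo p q).1 ↔ x ≠ p ∧ x ≠ p.succAbove q := by
  simp [omitTwo]

theorem orderEmbOfFin_omitTwo (p : Fin (k + 2)) (q : Fin (k + 1)) (i : Fin k) :
    (omitTwo p q).1.orderEmbOfFin (omitTwo p q).2 i = p.succAbove (q.succAbove i) := by
  have h := Finset.orderEmbOfFin_unique (omitTwo p q).2
    (f := fun i => p.succAbove (q.succAbove i))
    (fun i => mem_omitTwo.mpr ⟨Fin.succAbove_ne _ _, fun hc =>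
      Fin.succAbove_ne q i (Fin.succAbove_right_injective hc)⟩)
    ((Fin.strictMono_succAbove p).comp (Fin.strictMono_succAbove q))
  exact (congrFun h i).symm

theorem omitTwo_injective (p : Fin (k + 2)) : Function.Injective (omitTwo p) := by
  intro q q' h
  by_contra hne
  have h1 : p.succAbove q ∈ (omitTwo p q').1 :=
    mem_omitTwo.mpr ⟨Fin.succAbove_ne _ _, fun hc => hne (Fin.succAbove_right_injective hc)⟩
  rw [← h] at h1
  exact (mem_omitTwo.mp h1).2 rfl

theorem exists_omitTwo_eq {a : Fin (k + 2)} {s : Plu k} (ha : a ∉ s.1) :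
    ∃ i, omitTwo a i = s := by
  have h1 : (s.1ᶜ).card = 2 := by
    rw [Finset.card_compl, s.2, Fintype.card_fin]
    omega
  obtain ⟨x, hx, hxa⟩ := Finset.exists_mem_ne (by omega : 1 < (s.1ᶜ).card) a
  obtain ⟨i, rfl⟩ := Fin.exists_succAbove_eq hxa
  refine ⟨i, Subtype.ext (Finset.eq_of_subset_of_card_le ?_ ?_).symm⟩
  · intro y hy
    refine mem_omitTwo.mpr ⟨?_, ?_⟩
    · rintro rfl; exact ha hy
    · rintro rfl; exact (Finset.mem_compl.mp hx) hy
  · rw [(omitTwo a i).2, s.2]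

theorem dotProduct_join (u e : Fin (k + 2) → ℂ) (w : Fin k → Fin (k + 2) → ℂ) :
    u ⬝ᵥ join e w = Matrix.det (Matrix.of (Matrix.vecCons u (Matrix.vecCons e w))) := by
  have h : ∀ i, join e w i = (-1) ^ (i : ℕ) *
      Matrix.det ((Matrix.of (Matrix.vecCons u (Matrix.vecCons e w))).submatrix
        Fin.succ i.succAbove) := by
    intro i
    rw [join, Matrix.det_succ_row_zero, Finset.sum_eq_single i]
    · simp only [Matrix.of_apply, Matrix.cons_val_zero, Pi.single_eq_same, mul_one]
      rfl
    · intro b _ hb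
      simp [hb]
    · simp
  rw [Matrix.det_succ_row_zero, dotProduct]
  refine Finset.sum_congr rfl fun i _ => ?_
  rw [h i]
  simp only [Matrix.of_apply, Matrix.cons_val_zero]
  ring

/-- Laplace expansion of the join along its first two rows. -/
theorem join_eq_sum (e : Fin (k + 2) → ℂ) (w : Fin k → Fin (k + 2) → ℂ) (p : Fin (k + 2)) :
    join e w p = ∑ q : Fin (k + 1),
      (-1) ^ (p + q : ℕ) * e (p.succAbove q) * extensor w (omitTwo p q) := by
  rw [join, Matrix.det_succ_row_zero, Finset.sum_eq_single p]
  · rw [Matrix.det_succ_row_zero, Finset.mul_sum]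
    refine Finset.sum_congr rfl fun q _ => ?_
    have h : extensor w (omitTwo p q) = Matrix.det (((Matrix.of (Matrix.vecCons
        (Pi.single p (1 : ℂ)) (Matrix.vecCons e w))).submatrix Fin.succ p.succAbove).submatrix
        Fin.succ q.succAbove) := by
      rw [extensor, ← Matrix.det_transpose]
      congr 1
      ext i j
      simp [orderEmbOfFin_omitTwo]
    rw [← h]
    simp [pow_add]
    ring
  · intro b _ hb
    simp [hb]
  · simp

theorem join_smul_left (s : ℂ) (e : Fin (k + 2) → ℂ) (w : Fin k → Fin (k + 2) → ℂ) :
    join (s • e) w = s • join e w := by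
  ext p
  simp only [join_eq_sum, Pi.smul_apply, smul_eq_mul, Finset.mul_sum]
  exact Finset.sum_congr rfl fun q _ => by ring

theorem extensor_smul (r : ℂ) (w : Fin k → Fin (k + 2) → ℂ) :
    extensor (r • w) = r ^ k • extensor w := by
  ext s
  rw [Pi.smul_apply, smul_eq_mul, extensor, extensor]
  have := Matrix.det_smul (Matrix.of fun i j : Fin k => w j (s.1.orderEmbOfFin s.2 i)) r
  rw [Fintype.card_fin] at this
  rw [← this]
  rfl

theorem join_smul_right (r : ℂ) (e : Fin (k + 2) → ℂ) (w : Fin k → Fin (k + 2) → ℂ) :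
    join e (r • w) = r ^ k • join e w := by
  ext p
  simp only [join_eq_sum, extensor_smul, Pi.smul_apply, smul_eq_mul, Finset.mul_sum]
  exact Finset.sum_congr rfl fun q _ => by ring

theorem dotProduct_join_self (e : Fin (k + 2) → ℂ) (w : Fin k → Fin (k + 2) → ℂ) :
    e ⬝ᵥ join e w = 0 := by
  rw [dotProduct_join]
  refine Matrix.det_zero_of_row_eq (i := 0) (j := 1) (by simp) ?_
  ext i
  simp

theorem dotProduct_join_right (e : Fin (k + 2) → ℂ) (w : Fin k → Fin (k + 2) → ℂ) (j : Fin k) :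
    w j ⬝ᵥ join e w = 0 := by
  rw [dotProduct_join]
  refine Matrix.det_zero_of_row_eq (i := 0) (j := j.succ.succ) (Fin.succ_ne_zero _).symm ?_
  ext i
  simp

theorem join_eq_zero (e : Fin (k + 2) → ℂ) (w : Fin k → Fin (k + 2) → ℂ) (h : ∃ j, w j = e) :
    join e w = 0 := by
  obtain ⟨j, hj⟩ := h
  ext p
  rw [Pi.zero_apply, join]
  refine Matrix.det_zero_of_row_eq (i := 1) (j := j.succ.succ) ?_ ?_
  · intro hc
    have := congrArg Fin.val hc
    simp at this
  · ext i
    simp [hj]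

theorem join_add_smul (e : Fin (k + 2) → ℂ) (w : Fin k → Fin (k + 2) → ℂ) (c : Fin k → ℂ) :
    join e (fun j => w j + c j • e) = join e w := by
  ext p
  refine Matrix.det_eq_of_forall_row_eq_smul_add_const
    (Fin.cons 0 (Fin.cons 0 c) : Fin (k + 2) → ℂ) 1 rfl ?_
  intro i j
  refine Fin.cases (by simp) (fun i => Fin.cases (by simp) (fun i => ?_) i) i
  simp

/-- A coordinate of the extensor, as a multilinear map. -/
def extensorMultilinear (s : Plu k) :
    MultilinearMap ℂ (fun _ : Fin k => Fin (k + 2) → ℂ) ℂ :=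
  (Matrix.detRowAlternating (R := ℂ) (n := Fin k)).toMultilinearMap.compLinearMap
    fun _ => LinearMap.funLeft ℂ ℂ fun i => s.1.orderEmbOfFin s.2 i

theorem extensorMultilinear_apply (s : Plu k) (w : Fin k → Fin (k + 2) → ℂ) :
    extensorMultilinear s w = extensor w s := by
  rw [extensor, ← Matrix.det_transpose]
  rfl

/-- A linear form in the Plücker coordinates, as a multilinear map. -/
def pluckerForm (f : Plu k → ℂ) : MultilinearMap ℂ (fun _ : Fin k => Fin (k + 2) → ℂ) ℂ :=
  ∑ s, f s • extensorMultilinear s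

theorem pluckerForm_apply (f : Plu k → ℂ) (w : Fin k → Fin (k + 2) → ℂ) :
    pluckerForm f w = ∑ s, f s * extensor w s := by
  simp [pluckerForm, extensorMultilinear_apply]

theorem pluckerForm_add_smul {f : Plu k → ℂ} {e : Fin (k + 2) → ℂ}
    (hf : ∀ w, (∃ j, w j = e) → pluckerForm f w = 0) (w : Fin k → Fin (k + 2) → ℂ)
    (c : Fin k → ℂ) : pluckerForm f (fun j => w j + c j • e) = pluckerForm f w := by
  have h := (pluckerForm f).map_add_univ w (fun j => c j • e)
  change pluckerForm f (w + fun j => c j • e) = _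
  rw [h, Finset.sum_eq_single Finset.univ]
  · simp
  · intro s _ hs
    obtain ⟨j, hj⟩ : ∃ j, j ∉ s := by
      by_contra! hcon
      exact hs (Finset.eq_univ_iff_forall.mpr hcon)
    have h1 : s.piecewise w (fun j => c j • e)
        = Function.update (s.piecewise w (fun j => c j • e)) j (c j • e) := by
      rw [eq_comm, Function.update_eq_self_iff]
      simp [hj]
    rw [h1, MultilinearMap.map_update_smul, hf _ ⟨j, by simp⟩, smul_zero]
  · simp

theorem extensor_eq_zero {a : Fin (k + 2)} {w : Fin k → Fin (k + 2) → ℂ} (hw : ∀ j, w j a = 0)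
    {s : Plu k} (ha : a ∈ s.1) : extensor w s = 0 := by
  obtain ⟨i, hi⟩ : a ∈ Set.range (s.1.orderEmbOfFin s.2) := by
    rw [Finset.range_orderEmbOfFin]; exact ha
  refine Matrix.det_eq_zero_of_row_eq_zero i fun j => ?_
  rw [Matrix.of_apply, hi, hw]

/-- For vectors in the coordinate hyperplane with index `a`, the join with `e` has the surviving
Plücker coordinates as its coordinates, up to sign and the factor `e a`. -/
theorem exists_sign (a : Fin (k + 2)) : ∃ ε : Fin (k + 1) → ℂ, (∀ i, ε i * ε i = 1) ∧
    ∀ (e : Fin (k + 2) → ℂ) (w : Fin k → Fin (k + 2) → ℂ), (∀ j, w j a = 0) →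
      ∀ i, join e w (a.succAbove i) = ε i * e a * extensor w (omitTwo a i) := by
  have hq : ∀ i : Fin (k + 1), ∃ q, (a.succAbove i).succAbove q = a := fun i =>
    Fin.exists_succAbove_eq (Fin.succAbove_ne a i).symm
  choose q hq using hq
  refine ⟨fun i => (-1) ^ ((a.succAbove i : ℕ) + (q i : ℕ)), fun i => ?_, fun e w hw i => ?_⟩
  · rw [← mul_pow]; simp
  · rw [join_eq_sum, Finset.sum_eq_single (q i)]
    · have : omitTwo (a.succAbove i) (q i) = omitTwo a i := by
        apply Subtype.ext
        simp only [omitTwo, hq]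
        rw [Finset.pair_comm]
      rw [hq, this]
    · intro b _ hb
      have ha : a ∈ (omitTwo (a.succAbove i) b).1 := by
        refine mem_omitTwo.mpr ⟨(Fin.succAbove_ne a i).symm, fun hc => hb ?_⟩
        exact Fin.succAbove_right_injective ((hq i).trans hc).symm
      rw [extensor_eq_zero hw ha, mul_zero]
    · simp

/-- A linear form in the Plücker coordinates that kills all extensors with the factor `e` is a
function of the join with `e`. -/
theorem mul_pluckerForm_eq {a : Fin (k + 2)} {ε : Fin (k + 1) → ℂ} (hε : ∀ i, ε i * ε i = 1)
    (hεj : ∀ (e : Fin (k + 2) → ℂ) (w : Fin k → Fin (k + 2) → ℂ), (∀ j, w j a = 0) →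
      ∀ i, join e w (a.succAbove i) = ε i * e a * extensor w (omitTwo a i))
    {f : Plu k → ℂ} {e : Fin (k + 2) → ℂ} (ha : e a ≠ 0)
    (hf : ∀ w, (∃ j, w j = e) → pluckerForm f w = 0) (w : Fin k → Fin (k + 2) → ℂ) :
    e a * pluckerForm f w = ∑ i, f (omitTwo a i) * (ε i * join e w (a.succAbove i)) := by
  let c : Fin k → ℂ := fun j => -(w j a / e a)
  let w' : Fin k → Fin (k + 2) → ℂ := fun j => w j + c j • e
  have hw' : ∀ j, w' j a = 0 := by
    intro j
    simp only [w', c, Pi.add_apply, Pi.smul_apply, smul_eq_mul]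
    field_simp
    ring
  rw [← pluckerForm_add_smul hf w c, ← join_add_smul e w c]
  change e a * pluckerForm f w' = ∑ i, f (omitTwo a i) * (ε i * join e w' (a.succAbove i))
  rw [pluckerForm_apply, Finset.mul_sum]
  refine (Fintype.sum_of_injective (omitTwo a) (omitTwo_injective a) _ _ ?_ ?_).symm
  · intro s hs
    have has : a ∈ s.1 := by
      by_contra hc
      exact hs (exists_omitTwo_eq hc)
    rw [extensor_eq_zero hw' has, mul_zero, mul_zero]
  · intro i
    rw [hεj e w' hw']
    linear_combination (f (omitTwo a i) * e a * extensor w' (omitTwo a i)) * hε i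

/-- The coordinate vectors whose extensor is the coordinate vector with index `s`. -/
def basisVectors (s : Plu k) : Fin k → Fin (k + 2) → ℂ :=
  fun j => Pi.single (s.1.orderEmbOfFin s.2 j) 1

theorem extensor_basisVectors (s : Plu k) : extensor (basisVectors s) = Pi.single s 1 := by
  ext t
  by_cases h : t = s
  · subst h
    rw [Pi.single_eq_same, extensor, ← Matrix.det_one (n := Fin k)]
    congr 1
    ext i j
    simp [basisVectors, Matrix.one_apply, Pi.single_apply]
  · rw [Pi.single_eq_of_ne h, extensor]
    obtain ⟨x, hx, hxs⟩ : ∃ x ∈ t.1, x ∉ s.1 := by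
      by_contra! hcon
      exact h (Subtype.ext (Finset.eq_of_subset_of_card_le hcon (by rw [s.2, t.2])))
    obtain ⟨i, hi⟩ : x ∈ Set.range (t.1.orderEmbOfFin t.2) := by
      rw [Finset.range_orderEmbOfFin]; exact hx
    refine Matrix.det_eq_zero_of_row_eq_zero i fun j => ?_
    rw [Matrix.of_apply, hi, basisVectors, Pi.single_eq_of_ne]
    rintro rfl
    exact hxs (Finset.orderEmbOfFin_mem _ _ _)

theorem exists_pow_eq (hk : k ≠ 0) (c : ℂ) : ∃ r : ℂ, r ^ k = c :=
  IsAlgClosed.exists_pow_nat_eq c (Nat.pos_of_ne_zero hk)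

/-- Every hyperplane through `e` is a join with `e`. -/
theorem exists_join_eq (hk : k ≠ 0) {e : Fin (k + 2) → ℂ} (he : e ≠ 0) {y : Fin (k + 2) → ℂ}
    (hy : e ⬝ᵥ y = 0) : ∃ w, join e w = y := by
  by_cases hy0 : y = 0
  · refine ⟨0, ?_⟩
    have h := join_smul_right (0 : ℂ) e 0
    rw [zero_smul, zero_pow hk, zero_smul] at h
    rw [h, hy0]
  let T : Module.Dual ℂ (Fin (k + 2) → ℂ) := dotProductEquiv ℂ _ y
  have hT : T ≠ 0 := fun hT => hy0 ((dotProductEquiv ℂ _).map_eq_zero_iff.mp hT)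
  let W := LinearMap.ker T
  have hTv : ∀ v, T v = y ⬝ᵥ v := fun v => rfl
  have hW : Module.finrank ℂ W = k + 1 := by
    change Module.finrank ℂ (LinearMap.ker T) = k + 1
    have := Module.Dual.finrank_ker_add_one_of_ne_zero hT
    simp only [Module.finrank_fintype_fun_eq_card, Fintype.card_fin] at this
    omega
  have heW : e ∈ W := by
    rw [LinearMap.mem_ker, hTv, dotProduct_comm, hy]
  -- a basis of the hyperplane that begins with `e`
  obtain ⟨w, hwW, hli⟩ : ∃ w : Fin k → Fin (k + 2) → ℂ, (∀ j, w j ∈ W) ∧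
      LinearIndependent ℂ (Fin.cons e w : Fin (k + 1) → Fin (k + 2) → ℂ) := by
    let e' : W := ⟨e, heW⟩
    have he' : e' ≠ 0 := fun hc => he (congrArg Subtype.val hc)
    let Q := W ⧸ Submodule.span ℂ {e'}
    have hQ : Module.finrank ℂ Q = k := by
      have h1 := Submodule.finrank_quotient_add_finrank (Submodule.span ℂ {e'})
      rw [finrank_span_singleton he', hW] at h1
      exact Nat.add_right_cancel h1
    let b := Module.finBasisOfFinrankEq ℂ Q hQ
    choose w hw using fun j => Submodule.mkQ_surjective (Submodule.span ℂ {e'}) (b j)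
    have hli : LinearIndependent ℂ (Fin.cons e' w : Fin (k + 1) → W) := by
      rw [linearIndependent_finCons]
      constructor
      · refine LinearIndependent.of_comp (Submodule.mkQ (Submodule.span ℂ {e'})) ?_
        have : (Submodule.mkQ (Submodule.span ℂ {e'})) ∘ w = b := funext hw
        rw [this]
        exact b.linearIndependent
      · intro hmem
        obtain ⟨c, hc⟩ := (Submodule.mem_span_range_iff_exists_fun ℂ).mp hmem
        have h0 : Submodule.mkQ (Submodule.span ℂ {e'}) e' = 0 := by
          rw [Submodule.mkQ_apply, Submodule.Quotient.mk_eq_zero]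
          exact Submodule.mem_span_singleton_self e'
        have h2 : Submodule.mkQ (Submodule.span ℂ {e'}) (∑ i, c i • w i) = 0 := by rw [hc, h0]
        simp only [map_sum, map_smul, hw] at h2
        have h1 := Fintype.linearIndependent_iff.mp b.linearIndependent c h2
        apply he'
        rw [← hc]
        simp [h1]
    refine ⟨fun j => (w j : Fin (k + 2) → ℂ), fun j => (w j).2, ?_⟩
    have h2 := hli.map' W.subtype (Submodule.ker_subtype _)
    convert! h2 using 1
    ext i
    refine Fin.cases ?_ (fun i => ?_) i
    · rfl
    · rfl
  have hspan : Submodule.span ℂ (Set.range (Fin.cons e w : Fin (k + 1) → Fin (k + 2) → ℂ)) ≤ W := by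
    rw [Submodule.span_le]
    rintro _ ⟨i, rfl⟩
    refine Fin.cases heW (fun i => hwW i) i
  obtain ⟨u, hu⟩ : ∃ u, u ∉ W := by
    by_contra! hcon
    exact hT (LinearMap.ext fun v => hcon v)
  have hli2 : LinearIndependent ℂ
      (Fin.cons u (Fin.cons e w) : Fin (k + 2) → Fin (k + 2) → ℂ) :=
    linearIndependent_finCons.mpr ⟨hli, fun hc => hu (hspan hc)⟩
  have hne : u ⬝ᵥ join e w ≠ 0 := by
    rw [dotProduct_join]
    have h1 : IsUnit (Matrix.of (Fin.cons u (Fin.cons e w) : Fin (k + 2) → Fin (k + 2) → ℂ)) :=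
      Matrix.linearIndependent_rows_iff_isUnit.mp hli2
    exact ((Matrix.isUnit_iff_isUnit_det _).mp h1).ne_zero
  have hspan' :
      Submodule.span ℂ (Set.range (Fin.cons e w : Fin (k + 1) → Fin (k + 2) → ℂ)) = W := by
    refine Submodule.eq_of_le_of_finrank_eq hspan ?_
    rw [finrank_span_eq_card hli, hW, Fintype.card_fin]
  have horth : ∀ x ∈ W, x ⬝ᵥ join e w = 0 := by
    intro x hx
    rw [← hspan'] at hx
    refine Submodule.span_induction ?_ ?_ ?_ ?_ hx
    · rintro _ ⟨i, rfl⟩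
      exact Fin.cases (dotProduct_join_self e w) (fun i => dotProduct_join_right e w i) i
    · exact zero_dotProduct _
    · intro x y _ _ hx hy
      rw [add_dotProduct, hx, hy, add_zero]
    · intro t x _ hx
      rw [smul_dotProduct, hx, smul_zero]
  -- hence the join is a nonzero multiple of `y`
  obtain ⟨b, hb⟩ := Function.ne_iff.mp hy0
  rw [Pi.zero_apply] at hb
  have hJ : ∀ j, join e w j * y b = join e w b * y j := by
    intro j
    have h1 := horth (y b • Pi.single j 1 - y j • Pi.single b 1) (by
      rw [LinearMap.mem_ker, hTv, dotProduct_sub, dotProduct_smul, dotProduct_smul,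
        dotProduct_single, dotProduct_single]
      simp only [smul_eq_mul]
      ring)
    rw [sub_dotProduct, smul_dotProduct, smul_dotProduct, single_dotProduct,
      single_dotProduct] at h1
    simp only [smul_eq_mul, one_mul] at h1
    linear_combination h1
  have hJb : join e w b ≠ 0 := by
    intro hc
    apply hne
    have : join e w = 0 := by
      ext j
      have := hJ j
      rw [hc, zero_mul] at this
      exact (mul_eq_zero.mp this).resolve_right hb
    rw [this, dotProduct_zero]
  obtain ⟨r, hr⟩ := exists_pow_eq hk (y b / join e w b)
  refine ⟨r • w, ?_⟩
  rw [join_smul_right, hr]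
  ext j
  rw [Pi.smul_apply, smul_eq_mul]
  field_simp
  linear_combination hJ j

end Extensor

/-! ### The dimension of the space of fundamental matrices -/

section Fundamental

variable {k : ℕ}

/-- The matrix, with entries indexed by `Fin (k + 2) × Plu k`, of the linear map
`w₁ ∧ ⋯ ∧ wₖ ↦ b ∧ A w₁ ∧ ⋯ ∧ A wₖ`; the columns of the matrix `A` are given by `A`. -/
def joinMatrix {R : Type*} [CommRing R] (b : Fin (k + 2) → R)
    (A : Fin (k + 2) → Fin (k + 2) → R) : Fin (k + 2) × Plu k → R := fun x =>
  Matrix.det (Matrix.of (Matrix.vecCons (Pi.single x.1 1)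
    (Matrix.vecCons b fun j => A (x.2.1.orderEmbOfFin x.2.2 j))))

theorem joinMatrix_apply (b : Fin (k + 2) → ℂ) (A : Fin (k + 2) → Fin (k + 2) → ℂ)
    (x : Fin (k + 2) × Plu k) :
    joinMatrix b A x = join b (fun j => A (x.2.1.orderEmbOfFin x.2.2 j)) x.1 := rfl

theorem map_joinMatrix {R S : Type*} [CommRing R] [CommRing S] (f : R →+* S) (b : Fin (k + 2) → R)
    (A : Fin (k + 2) → Fin (k + 2) → R) (x : Fin (k + 2) × Plu k) :
    f (joinMatrix b A x) = joinMatrix (fun i => f (b i)) (fun q i => f (A q i)) x := by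
  rw [joinMatrix, joinMatrix, RingHom.map_det]
  congr 1
  ext i j
  refine Fin.cases ?_ (fun i => Fin.cases ?_ (fun i => ?_) i) i
  · by_cases h : j = x.1
    · subst h; simp
    · simp [h]
  · simp
  · simp

theorem apply_single (F : Fin (k + 2) × Plu k → ℂ) (s : Plu k) (i : Fin (k + 2)) :
    apply F (Pi.single s 1) i = F (i, s) := by
  rw [apply, Finset.sum_eq_single s]
  · simp
  · intro t _ ht
    simp [ht]
  · simp

theorem exists_eq_joinMatrix {M₁ M₂ : Matrix (Fin (k + 2)) (Fin (k + 3)) ℂ}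
    (hM : IsProjectionPair M₁ M₂) {F : Fin (k + 2) × Plu k → ℂ}
    (hF : IsFundamentalMatrix M₁ M₂ F) :
    ∃ (b : Fin (k + 2) → ℂ) (A : Fin (k + 2) → Fin (k + 2) → ℂ), b ≠ 0 ∧ F = joinMatrix b A := by
  obtain ⟨O, hO0, hO, hP⟩ := hF
  have hsurj : ∀ y, ∃ v, M₁.mulVec v = y := by
    have h1 : LinearMap.range M₁.mulVecLin = ⊤ := by
      apply Submodule.eq_top_of_finrank_eq
      rw [Module.finrank_fintype_fun_eq_card, Fintype.card_fin]
      exact hM.1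
    exact LinearMap.range_eq_top.mp h1
  choose R hR using hsurj
  refine ⟨M₂.mulVec O, fun q => M₂.mulVec (R (Pi.single q 1)),
    fun hc => hO0 (hM.2.2 O hO hc), ?_⟩
  ext ⟨i, s⟩
  have h1 := congrFun (hP fun j => R (basisVectors s j)) i
  simp only [hR] at h1
  rw [extensor_basisVectors, apply_single] at h1
  rw [h1]
  rfl

/-- The coefficients that parametrize the fundamental matrices whose second epipole has a nonzero
coordinate with index `a`: the other coordinates of the epipole, scaled to have coordinate `1`
there, and the rows with index other than `a` of a matrix whose row with index `a` is zero. -/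
abbrev FundParam (k : ℕ) : Type := Fin (k + 1) ⊕ Fin (k + 1) × Fin (k + 2)

/-- The polynomial parametrization of the fundamental matrices whose second epipole has a nonzero
coordinate with index `a`. -/
def fundParam (a : Fin (k + 2)) : Fin (k + 2) × Plu k → MvPolynomial (FundParam k) ℂ :=
  joinMatrix (a.insertNth 1 fun l => X (Sum.inl l))
    (fun q => a.insertNth 0 fun l => X (Sum.inr (l, q)))

/-- The joins do not change when multiples of `b` are added to the columns of `A`, and the scalar
`t * b a` is absorbed by a `k`-th root. -/
theorem exists_fundParam_eq (hk : k ≠ 0) {b : Fin (k + 2) → ℂ} (hb : b ≠ 0)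
    (A : Fin (k + 2) → Fin (k + 2) → ℂ) (t : ℂ) :
    ∃ a y, t • joinMatrix b A = fun i => eval y (fundParam a i) := by
  obtain ⟨a, ha⟩ := Function.ne_iff.mp hb
  rw [Pi.zero_apply] at ha
  obtain ⟨r, hr⟩ := exists_pow_eq hk (t * b a)
  -- subtract a multiple of `b` from each column to clear the row with index `a`
  let A' : Fin (k + 2) → Fin (k + 2) → ℂ := fun q => A q + (-(A q a / b a)) • b
  let y : FundParam k → ℂ := Sum.elim (fun l => (b a)⁻¹ * b (a.succAbove l))
    (fun lq => r * A' lq.2 (a.succAbove lq.1))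
  refine ⟨a, y, ?_⟩
  ext x
  rw [fundParam, map_joinMatrix]
  have h1 : (fun i => eval y (a.insertNth (α := fun _ => MvPolynomial (FundParam k) ℂ) 1
      (fun l => X (Sum.inl l)) i)) = (b a)⁻¹ • b := by
    ext i
    refine Fin.succAboveCases a ?_ (fun l => ?_) i
    · simp [ha]
    · simp [y]
  have h2 : (fun q i => eval y (a.insertNth (α := fun _ => MvPolynomial (FundParam k) ℂ) 0
      (fun l => X (Sum.inr (l, q))) i)) = r • A' := by
    ext q i
    refine Fin.succAboveCases a ?_ (fun l => ?_) i
    · simp [A', ha]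
    · simp [y]
  rw [h1, h2, joinMatrix_apply, Pi.smul_apply, joinMatrix_apply]
  have h3 := join_add_smul b (fun j => A (x.2.1.orderEmbOfFin x.2.2 j))
    (fun j => -(A (x.2.1.orderEmbOfFin x.2.2 j) a / b a))
  have h4 := join_smul_right r ((b a)⁻¹ • b) (fun j => A' (x.2.1.orderEmbOfFin x.2.2 j))
  rw [join_smul_left] at h4
  have h5 : (fun j => (r • A') (x.2.1.orderEmbOfFin x.2.2 j))
      = r • (fun j => A' (x.2.1.orderEmbOfFin x.2.2 j)) := rfl
  rw [h5, join_smul_left, Pi.smul_apply] at *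
  have h6 := congrFun h4 x.1
  rw [Pi.smul_apply] at h6
  rw [h6, hr, ← h3]
  simp only [Pi.smul_apply, smul_eq_mul, A']
  field_simp

theorem projDim_fundamentalMatrices_le (hk : k ≠ 0) :
    projDim (fundamentalMatrices k) ≤ (k + 1) * (k + 3) - 1 := by
  have h := affineDim_le_of_subset_iUnion (A := cone (fundamentalMatrices k)) fundParam (by
    rintro x ⟨hx, F, hF, hxF, M₁, M₂, hM, hMF⟩
    obtain ⟨t, rfl⟩ := (Projectivization.mk_eq_mk_iff' ℂ _ _ hx hF).mp hxF
    obtain ⟨b, A, hb, rfl⟩ := exists_eq_joinMatrix hM hMF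
    exact exists_fundParam_eq hk hb A t)
  have hc : Fintype.card (FundParam k) = (k + 1) * (k + 3) := by
    simp only [FundParam, Fintype.card_sum, Fintype.card_prod, Fintype.card_fin]
    ring
  rw [hc] at h
  rw [projDim]
  push_cast at h
  linarith

end Fundamental

/-! ### Linear substitutions with parameters, and proportional forms -/

section Proportional

/-- Composition of a polynomial with a linear map whose matrix depends polynomially on parameters:
the coefficients of the result are polynomials in the parameters. -/
def paramSubst {σ : Type} {m n : ℕ} (A : Matrix (Fin m) (Fin n) (MvPolynomial σ ℂ)) :
    MvPolynomial (Fin m) ℂ →+* MvPolynomial (Fin n) (MvPolynomial σ ℂ) :=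
  eval₂Hom (C.comp C) fun i => ∑ j, C (A i j) * X j

theorem eval_coeff_paramSubst {σ : Type} {m n : ℕ} (A : Matrix (Fin m) (Fin n) (MvPolynomial σ ℂ))
    (x : σ → ℂ) (φ : MvPolynomial (Fin m) ℂ) (α : Fin n →₀ ℕ) :
    eval x (coeff α (paramSubst A φ)) = coeff α (linSubst (A.map (eval x)) φ) := by
  rw [← coeff_map]
  congr 1
  have h : (map (eval x)).comp (paramSubst A)
      = (linSubst (A.map (eval x))).toRingHom := by
    apply MvPolynomial.ringHom_ext
    · intro r
      simp [paramSubst]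
    · intro i
      simp [paramSubst, linSubst, linForm]
  exact congrArg (fun f => f φ) h

theorem card_finsuppAntidiag_fin (k d : ℕ) :
    ((Finset.univ : Finset (Fin (k + 1))).finsuppAntidiag d).card = (k + d).choose d := by
  rw [Finset.card_finsuppAntidiag_nat_eq_choose, Finset.card_univ, Fintype.card_fin]
  congr 1
  omega

theorem eq_C_mul_of_coeff_mul_eq {k d : ℕ} {p q : MvPolynomial (Fin (k + 1)) ℂ}
    (hp : p.IsHomogeneous d) (hq : q.IsHomogeneous d) {α : Fin (k + 1) →₀ ℕ} (hα : coeff α q ≠ 0)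
    (h : ∀ β ∈ (Finset.univ : Finset (Fin (k + 1))).finsuppAntidiag d, β ≠ α →
      coeff β p * coeff α q - coeff α p * coeff β q = 0) :
    p = C (coeff α p / coeff α q) * q := by
  ext β
  rw [coeff_C_mul]
  by_cases hβ : β.degree = d
  · by_cases hβα : β = α
    · subst hβα
      field_simp
    · have h1 := h β (Finset.mem_finsuppAntidiag.mpr
        ⟨by rw [← hβ, Finsupp.degree_eq_sum], Finset.subset_univ _⟩) hβα
      field_simp
      linear_combination h1
  · rw [hp.coeff_eq_zero hβ, hq.coeff_eq_zero hβ, mul_zero]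

end Proportional

/-! ### Charts of the solution variety -/

section Solution

variable {k : ℕ} {φ₁ φ₂ : MvPolynomial (Fin (k + 2)) ℂ}

theorem apply_extensor (F : Fin (k + 2) × Plu k → ℂ) (w : Fin k → Fin (k + 2) → ℂ)
    (i : Fin (k + 2)) : apply F (extensor w) i = pluckerForm (fun s => F (i, s)) w := by
  rw [pluckerForm_apply, apply]

theorem apply_smul (t : ℂ) (F : Fin (k + 2) × Plu k → ℂ) (p : Plu k → ℂ) :
    apply (t • F) p = t • apply F p := by
  ext i
  simp only [apply, Pi.smul_apply, smul_eq_mul, Finset.mul_sum, mul_assoc]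

/-- The conditions on a triple do not depend on the choice of homogeneous coordinates. -/
theorem IsSolution.smul {d₁ d₂ : ℕ} (h₁ : φ₁.IsHomogeneous d₁) (h₂ : φ₂.IsHomogeneous d₂)
    {e : Fin (k + 2) → ℂ} {F : Fin (k + 2) × Plu k → ℂ} {e₂ : Fin (k + 2) → ℂ}
    (h : IsSolution φ₁ φ₂ e F e₂) {s t : ℂ} (hs : s ≠ 0) (ht : t ≠ 0) (r : ℂ) :
    IsSolution φ₁ φ₂ (s • e) (t • F) (r • e₂) := by
  obtain ⟨hF, ⟨lam, hlam, hK⟩, he₂⟩ := h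
  refine ⟨?_, ⟨t ^ d₂ * lam / s ^ d₁, ?_, fun w => ?_⟩, fun p => ?_⟩
  · rintro w ⟨j, hj⟩
    ext i
    have h1 : w = Function.update w j (s • e) := by simp [← hj]
    have h2 := congrFun (hF (Function.update w j e) ⟨j, by simp⟩) i
    rw [apply_extensor, Pi.zero_apply] at h2
    rw [apply_smul, Pi.smul_apply, apply_extensor, h1, MultilinearMap.map_update_smul, h2]
    simp
  · positivity
  · rw [apply_smul, join_smul_left, eval_smul_of_isHomogeneous h₂, eval_smul_of_isHomogeneous h₁,
      hK]
    field_simp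
  · have h1 : ∑ i, (t • F) (i, p) * (r • e₂) i = t * r * ∑ i, F (i, p) * e₂ i := by
      rw [Finset.mul_sum]
      refine Finset.sum_congr rfl fun i _ => ?_
      simp only [Pi.smul_apply, smul_eq_mul]
      ring
    rw [h1, he₂, mul_zero]

theorem mem_cone₃_solutionVariety {d₁ d₂ : ℕ} (h₁ : φ₁.IsHomogeneous d₁)
    (h₂ : φ₂.IsHomogeneous d₂) {e : Fin (k + 2) → ℂ} {F : Fin (k + 2) × Plu k → ℂ}
    {e₂ : Fin (k + 2) → ℂ} (he : e ≠ 0) (hF : F ≠ 0) (he₂ : e₂ ≠ 0)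
    (h : IsSolution φ₁ φ₂ e F e₂) :
    Sum.elim e (Sum.elim F e₂) ∈ cone₃ (solutionVariety φ₁ φ₂) := by
  refine ⟨he, hF, he₂, ?_⟩
  obtain ⟨s, hs⟩ := Projectivization.exists_smul_eq_mk_rep ℂ e he
  obtain ⟨t, ht⟩ := Projectivization.exists_smul_eq_mk_rep ℂ F hF
  obtain ⟨r, hr⟩ := Projectivization.exists_smul_eq_mk_rep ℂ e₂ he₂
  change IsSolution φ₁ φ₂ (Projectivization.mk ℂ e he).rep (Projectivization.mk ℂ F hF).rep
    (Projectivization.mk ℂ e₂ he₂).rep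
  rw [← hs, ← ht, ← hr]
  exact h.smul h₁ h₂ s.ne_zero t.ne_zero r

theorem exists_eq_smul_of_mem_cone₃ {ι κ τ : Type} {V : Set (PSpace ι × PSpace κ × PSpace τ)}
    {x : ι ⊕ κ ⊕ τ → ℂ} (hx : x ∈ cone₃ V) : ∃ p ∈ V, ∃ s t r : ℂ,
      x = Sum.elim (s • p.1.rep) (Sum.elim (t • p.2.1.rep) (r • p.2.2.rep)) := by
  obtain ⟨h₁, h₂, h₃, h⟩ := hx
  obtain ⟨s, -, hs⟩ := exists_smul_rep h₁
  obtain ⟨t, -, ht⟩ := exists_smul_rep h₂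
  obtain ⟨r, -, hr⟩ := exists_smul_rep h₃
  refine ⟨_, h, s, t, r, ?_⟩
  ext (i | i | i)
  · exact congrFun hs i
  · exact congrFun ht i
  · exact congrFun hr i

/-- The multi-cone over a finite set is contained in a finite union of three-dimensional linear
subspaces. -/
theorem projDim₃_le_zero_of_finite {ι κ τ : Type} [Fintype ι] [Fintype κ] [Fintype τ]
    {V : Set (PSpace ι × PSpace κ × PSpace τ)} (hV : V.Finite) : projDim₃ V ≤ 0 := by
  have := hV.to_subtype
  have h := affineDim_le_of_subset_iUnion (A := cone₃ V) (τ := Fin 3) (T := V)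
    (fun p => Sum.elim (fun i => X 0 * C (p.1.1.rep i))
      (Sum.elim (fun i => X 1 * C (p.1.2.1.rep i)) (fun i => X 2 * C (p.1.2.2.rep i)))) (by
    intro x hx
    obtain ⟨p, hp, s, t, r, rfl⟩ := exists_eq_smul_of_mem_cone₃ hx
    refine ⟨⟨p, hp⟩, ![s, t, r], ?_⟩
    ext (i | i | i) <;> simp)
  rw [Fintype.card_fin] at h
  rw [projDim₃]
  push_cast at h
  linarith

/-- The matrix of the linear parametrization of the hyperplanes through `e` by `Fin (k + 1) → ℂ`,
where the coordinate of `e` with index `a` is nonzero, normalized by the signs of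
`exists_sign`. -/
def hyperplaneMatrix {R : Type*} [CommRing R] (a : Fin (k + 2)) (ε : Fin (k + 1) → R)
    (e : Fin (k + 2) → R) : Matrix (Fin (k + 2)) (Fin (k + 1)) R :=
  Matrix.of (a.insertNth (fun i => -(ε i * e (a.succAbove i)))
    fun l i => if l = i then e a * ε i else 0)

/-- The matrix with all columns orthogonal to `e₂` whose rows with index other than `b` are those
of `e₂ b • G`. -/
def orthogonalMatrix {R : Type*} [CommRing R] (b : Fin (k + 2)) (e₂ : Fin (k + 2) → R)
    (G : Fin (k + 1) × Fin (k + 1) → R) : Matrix (Fin (k + 2)) (Fin (k + 1)) R :=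
  Matrix.of (b.insertNth (fun i => -∑ l, e₂ (b.succAbove l) * G (l, i))
    fun l i => e₂ b * G (l, i))

theorem hyperplaneMatrix_map {R S : Type*} [CommRing R] [CommRing S] (f : R →+* S)
    (a : Fin (k + 2)) (ε : Fin (k + 1) → R) (e : Fin (k + 2) → R) :
    (hyperplaneMatrix a ε e).map f = hyperplaneMatrix a (fun i => f (ε i)) (fun i => f (e i)) := by
  ext j i
  refine Fin.succAboveCases a ?_ (fun l => ?_) j
  · simp [hyperplaneMatrix]
  · simp [hyperplaneMatrix, apply_ite f]

theorem orthogonalMatrix_map {R S : Type*} [CommRing R] [CommRing S] (f : R →+* S)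
    (b : Fin (k + 2)) (e₂ : Fin (k + 2) → R) (G : Fin (k + 1) × Fin (k + 1) → R) :
    (orthogonalMatrix b e₂ G).map f
      = orthogonalMatrix b (fun i => f (e₂ i)) (fun i => f (G i)) := by
  ext j i
  refine Fin.succAboveCases b ?_ (fun l => ?_) j
  · simp [orthogonalMatrix]
  · simp [orthogonalMatrix]

theorem sum_orthogonalMatrix (b : Fin (k + 2)) (e₂ : Fin (k + 2) → ℂ)
    (G : Fin (k + 1) × Fin (k + 1) → ℂ) (i : Fin (k + 1)) :
    ∑ j, orthogonalMatrix b e₂ G j i * e₂ j = 0 := by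
  rw [Fin.sum_univ_succAbove _ b]
  simp only [orthogonalMatrix, Matrix.of_apply, Fin.insertNth_apply_same,
    Fin.insertNth_apply_succAbove, neg_mul, Finset.sum_mul]
  rw [neg_add_eq_zero]
  exact Finset.sum_congr rfl fun l _ => by ring

theorem hyperplaneMatrix_mulVec_succAbove (a : Fin (k + 2)) (ε : Fin (k + 1) → ℂ)
    (e : Fin (k + 2) → ℂ) (z : Fin (k + 1) → ℂ) (i : Fin (k + 1)) :
    (hyperplaneMatrix a ε e).mulVec z (a.succAbove i) = e a * ε i * z i := by
  simp [hyperplaneMatrix, Matrix.mulVec, dotProduct]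

theorem dotProduct_hyperplaneMatrix_mulVec (a : Fin (k + 2)) (ε : Fin (k + 1) → ℂ)
    (e : Fin (k + 2) → ℂ) (z : Fin (k + 1) → ℂ) :
    e ⬝ᵥ (hyperplaneMatrix a ε e).mulVec z = 0 := by
  rw [dotProduct, Fin.sum_univ_succAbove _ a]
  simp only [hyperplaneMatrix_mulVec_succAbove]
  simp only [hyperplaneMatrix, Matrix.mulVec, dotProduct, Matrix.of_apply,
    Fin.insertNth_apply_same, Finset.mul_sum]
  rw [← Finset.sum_add_distrib]
  exact Finset.sum_eq_zero fun i _ => by ring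

theorem hyperplaneMatrix_mulVec_eq {a : Fin (k + 2)} {ε : Fin (k + 1) → ℂ}
    (hε : ∀ i, ε i * ε i = 1) {e : Fin (k + 2) → ℂ} (ha : e a ≠ 0) {y : Fin (k + 2) → ℂ}
    (hy : e ⬝ᵥ y = 0) :
    (hyperplaneMatrix a ε e).mulVec (fun i => ε i * y (a.succAbove i) / e a) = y := by
  have h1 : ∀ i, (hyperplaneMatrix a ε e).mulVec (fun i => ε i * y (a.succAbove i) / e a)
      (a.succAbove i) = y (a.succAbove i) := by
    intro i
    rw [hyperplaneMatrix_mulVec_succAbove]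
    field_simp
    linear_combination y (a.succAbove i) * hε i
  have h2 := dotProduct_hyperplaneMatrix_mulVec a ε e fun i => ε i * y (a.succAbove i) / e a
  rw [dotProduct, Fin.sum_univ_succAbove _ a] at h2 hy
  simp only [h1] at h2
  ext j
  refine Fin.succAboveCases a ?_ h1 j
  exact mul_left_cancel₀ ha (by linear_combination h2 - hy)

/-- In the chart `e a ≠ 0`, `e₂ b ≠ 0`, the map `e ∧ w ↦ F w` given by a solution has the
matrix `orthogonalMatrix`, up to the factor `e₂ b`. -/
theorem exists_join_eq_and_apply_eq (hk : k ≠ 0) {a b : Fin (k + 2)} {ε : Fin (k + 1) → ℂ}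
    (hε : ∀ i, ε i * ε i = 1)
    (hεj : ∀ (e : Fin (k + 2) → ℂ) (w : Fin k → Fin (k + 2) → ℂ), (∀ j, w j a = 0) →
      ∀ i, join e w (a.succAbove i) = ε i * e a * extensor w (omitTwo a i))
    {e e₂ : Fin (k + 2) → ℂ} {F : Fin (k + 2) × Plu k → ℂ} (ha : e a ≠ 0)
    (hF : ∀ w, (∃ j, w j = e) → apply F (extensor w) = 0)
    (he₂ : ∀ s : Plu k, ∑ i, F (i, s) * e₂ i = 0) (z : Fin (k + 1) → ℂ) :
    ∃ w, join e w = (hyperplaneMatrix a ε e).mulVec z ∧ e₂ b • apply F (extensor w) =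
      (orthogonalMatrix b e₂ fun x => F (b.succAbove x.1, omitTwo a x.2)).mulVec z := by
  have he : e ≠ 0 := fun hc => ha (congrFun hc a)
  obtain ⟨w, hw⟩ := exists_join_eq hk he (dotProduct_hyperplaneMatrix_mulVec a ε e z)
  refine ⟨w, hw, ?_⟩
  have h1 : ∀ j, apply F (extensor w) j = ∑ i, F (j, omitTwo a i) * z i := by
    intro j
    have h2 := mul_pluckerForm_eq hε hεj ha (f := fun s => F (j, s)) (fun w hw' => by
      rw [← apply_extensor, hF w hw', Pi.zero_apply]) w
    rw [← apply_extensor, hw] at h2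
    apply mul_left_cancel₀ ha
    rw [h2, Finset.mul_sum]
    refine Finset.sum_congr rfl fun i _ => ?_
    rw [hyperplaneMatrix_mulVec_succAbove]
    linear_combination F (j, omitTwo a i) * e a * z i * hε i
  ext j
  rw [Pi.smul_apply, h1, smul_eq_mul, Matrix.mulVec, dotProduct, Finset.mul_sum]
  refine Finset.sum_congr rfl fun i _ => ?_
  rw [← mul_assoc]
  congr 1
  refine Fin.succAboveCases b ?_ (fun l => ?_) j
  · have h3 := he₂ (omitTwo a i)
    rw [Fin.sum_univ_succAbove _ b] at h3
    simp only [orthogonalMatrix, Matrix.of_apply, Fin.insertNth_apply_same]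
    rw [eq_neg_iff_add_eq_zero, ← h3, mul_comm]
    congr 1
    exact Finset.sum_congr rfl fun l _ => mul_comm _ _
  · simp [orthogonalMatrix]

/-- The coefficients of the linear form in the Plücker coordinates whose value is the coordinate
with index `p` of the join with `e`. -/
def joinForm (e : Fin (k + 2) → ℂ) (p : Fin (k + 2)) (s : Plu k) : ℂ :=
  ∑ q, if omitTwo p q = s then (-1) ^ (p + q : ℕ) * e (p.succAbove q) else 0

theorem sum_joinForm (e : Fin (k + 2) → ℂ) (w : Fin k → Fin (k + 2) → ℂ) (p : Fin (k + 2)) :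
    ∑ s, joinForm e p s * extensor w s = join e w p := by
  simp only [joinForm, Finset.sum_mul]
  rw [Finset.sum_comm, join_eq_sum]
  refine Finset.sum_congr rfl fun q _ => ?_
  simp [ite_mul]

/-- Every choice of the parameters in the chart comes from a matrix `F` that satisfies the linear
conditions on a solution. -/
theorem exists_matrix_of_chart {a b : Fin (k + 2)} {ε : Fin (k + 1) → ℂ}
    (hε : ∀ i, ε i * ε i = 1)
    (hεj : ∀ (e : Fin (k + 2) → ℂ) (w : Fin k → Fin (k + 2) → ℂ), (∀ j, w j a = 0) →
      ∀ i, join e w (a.succAbove i) = ε i * e a * extensor w (omitTwo a i))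
    {e e₂ : Fin (k + 2) → ℂ} (ha : e a ≠ 0) (hb : e₂ b ≠ 0)
    (G : Fin (k + 1) × Fin (k + 1) → ℂ) : ∃ F : Fin (k + 2) × Plu k → ℂ,
      (∀ w, (∃ j, w j = e) → apply F (extensor w) = 0) ∧
      (∀ s : Plu k, ∑ i, F (i, s) * e₂ i = 0) ∧
      (∀ x : Fin (k + 1) × Fin (k + 1), F (b.succAbove x.1, omitTwo a x.2) = G x) ∧
      ∀ w, e₂ b • apply F (extensor w) = (orthogonalMatrix b e₂ G).mulVec
        fun i => ε i * join e w (a.succAbove i) / e a := by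
  let A := orthogonalMatrix b e₂ G
  let F : Fin (k + 2) × Plu k → ℂ := fun x =>
    ∑ i, A x.1 i / e₂ b * (ε i * joinForm e (a.succAbove i) x.2 / e a)
  have hF : ∀ w, e₂ b • apply F (extensor w) = A.mulVec
      fun i => ε i * join e w (a.succAbove i) / e a := by
    intro w
    ext j
    simp only [Pi.smul_apply, smul_eq_mul, apply, F, Matrix.mulVec, dotProduct, ← sum_joinForm,
      Finset.mul_sum, Finset.sum_mul, Finset.sum_div]
    rw [Finset.sum_comm]
    refine Finset.sum_congr rfl fun i _ => Finset.sum_congr rfl fun s _ => ?_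
    field_simp
  refine ⟨F, fun w hw => ?_, fun s => ?_, fun x => ?_, hF⟩
  · have h1 := hF w
    rw [join_eq_zero e w hw] at h1
    have h2 : e₂ b • apply F (extensor w) = 0 := by
      rw [h1, ← A.mulVec_zero]
      congr 1
      ext i
      simp
    exact (smul_eq_zero.mp h2).resolve_left hb
  · simp only [F, Finset.sum_mul]
    rw [Finset.sum_comm]
    refine Finset.sum_eq_zero fun i _ => ?_
    have h1 := sum_orthogonalMatrix b e₂ G i
    calc _ = (∑ j, A j i * e₂ j) * (ε i * joinForm e (a.succAbove i) s / e a / e₂ b) := by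
          rw [Finset.sum_mul]
          exact Finset.sum_congr rfl fun j _ => by ring
      _ = 0 := by rw [h1, zero_mul]
  · obtain ⟨l, i⟩ := x
    -- evaluate on the coordinate vectors, which lie in the coordinate hyperplane of index `a`
    have hw : ∀ j, basisVectors (omitTwo a i) j a = 0 := by
      intro j
      rw [basisVectors, Pi.single_eq_of_ne]
      intro hc
      have := Finset.orderEmbOfFin_mem _ (omitTwo a i).2 j
      rw [← hc] at this
      exact (mem_omitTwo.mp this).1 rfl
    have h1 := congrFun (hF (basisVectors (omitTwo a i))) (b.succAbove l)
    rw [Matrix.mulVec, dotProduct, Finset.sum_eq_single i] at h1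
    · rw [hεj e _ hw, extensor_basisVectors, Pi.smul_apply, apply_single, Pi.single_eq_same] at h1
      have h2 : A (b.succAbove l) i = e₂ b * G (l, i) := by simp [A, orthogonalMatrix]
      change e₂ b * F (b.succAbove l, omitTwo a i) = A (b.succAbove l) i * _ at h1
      rw [h2] at h1
      apply mul_left_cancel₀ hb
      rw [h1]
      field_simp
      linear_combination G (l, i) * hε i
    · intro i' _ hi'
      rw [hεj e _ hw, extensor_basisVectors,
        Pi.single_eq_of_ne fun hc => hi' (omitTwo_injective a hc)]
      simp
    · simp

end Solution

/-! ### The dimension of the solution variety -/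

section Chart

variable {k : ℕ} {φ₁ φ₂ : MvPolynomial (Fin (k + 2)) ℂ}

/-- The parameters of the chart: the coordinates of the first point, those of the second one, and
the free entries of the matrix. -/
abbrev ChartParam (k : ℕ) : Type := Fin (k + 2) ⊕ Fin (k + 2) ⊕ Fin (k + 1) × Fin (k + 1)

/-- The left-hand side `φ₂ (F w)` of the Kruppa equation in the chart, up to a factor: a form in
the parameter `z` of the hyperplane `e ∧ w`. -/
def leftForm (b : Fin (k + 2)) (φ : MvPolynomial (Fin (k + 2)) ℂ) :
    MvPolynomial (Fin (k + 1)) (MvPolynomial (ChartParam k) ℂ) :=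
  paramSubst (orthogonalMatrix b (fun i => X (Sum.inr (Sum.inl i)))
    fun i => X (Sum.inr (Sum.inr i))) φ

/-- The right-hand side `φ₁ (e ∧ w)` of the Kruppa equation in the chart. -/
def rightForm (a : Fin (k + 2)) (ε : Fin (k + 1) → ℂ) (φ : MvPolynomial (Fin (k + 2)) ℂ) :
    MvPolynomial (Fin (k + 1)) (MvPolynomial (ChartParam k) ℂ) :=
  paramSubst (hyperplaneMatrix a (fun i => C (ε i)) fun i => X (Sum.inl i)) φ

theorem eval_coeff_leftForm (b : Fin (k + 2)) (φ : MvPolynomial (Fin (k + 2)) ℂ)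
    (x : ChartParam k → ℂ) (α : Fin (k + 1) →₀ ℕ) :
    eval x (coeff α (leftForm b φ)) = coeff α (linSubst (orthogonalMatrix b
      (fun i => x (Sum.inr (Sum.inl i))) fun i => x (Sum.inr (Sum.inr i))) φ) := by
  rw [leftForm, eval_coeff_paramSubst, orthogonalMatrix_map]
  simp only [eval_X]

theorem eval_coeff_rightForm (a : Fin (k + 2)) (ε : Fin (k + 1) → ℂ)
    (φ : MvPolynomial (Fin (k + 2)) ℂ) (x : ChartParam k → ℂ) (α : Fin (k + 1) →₀ ℕ) :
    eval x (coeff α (rightForm a ε φ))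
      = coeff α (linSubst (hyperplaneMatrix a ε fun i => x (Sum.inl i)) φ) := by
  rw [rightForm, eval_coeff_paramSubst, hyperplaneMatrix_map]
  simp only [eval_X, eval_C]

/-- A solution makes the two forms of the chart proportional. -/
theorem linSubst_eq_of_isSolution (hk : k ≠ 0) {d₂ : ℕ} (h₂ : φ₂.IsHomogeneous d₂)
    {a b : Fin (k + 2)} {ε : Fin (k + 1) → ℂ} (hε : ∀ i, ε i * ε i = 1)
    (hεj : ∀ (e : Fin (k + 2) → ℂ) (w : Fin k → Fin (k + 2) → ℂ), (∀ j, w j a = 0) →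
      ∀ i, join e w (a.succAbove i) = ε i * e a * extensor w (omitTwo a i))
    {e e₂ : Fin (k + 2) → ℂ} {F : Fin (k + 2) × Plu k → ℂ} (ha : e a ≠ 0) (hb : e₂ b ≠ 0)
    (h : IsSolution φ₁ φ₂ e F e₂) : ∃ c, c ≠ 0 ∧
      linSubst (orthogonalMatrix b e₂ fun x => F (b.succAbove x.1, omitTwo a x.2)) φ₂
        = C c * linSubst (hyperplaneMatrix a ε e) φ₁ := by
  obtain ⟨hF, ⟨lam, hlam, hK⟩, he₂⟩ := h
  refine ⟨e₂ b ^ d₂ * lam, mul_ne_zero (pow_ne_zero _ hb) hlam, ?_⟩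
  apply MvPolynomial.funext
  intro z
  obtain ⟨w, hw, hw₂⟩ := exists_join_eq_and_apply_eq hk (b := b) hε hεj ha hF he₂ z
  rw [map_mul, eval_C, eval_linSubst, eval_linSubst, ← hw, ← hw₂,
    eval_smul_of_isHomogeneous h₂, hK]
  ring

/-- If the two forms of the chart are proportional, the Kruppa equation holds. -/
theorem isSolution_of_linSubst_eq {d₂ : ℕ} (h₂ : φ₂.IsHomogeneous d₂)
    {a b : Fin (k + 2)} {ε : Fin (k + 1) → ℂ} (hε : ∀ i, ε i * ε i = 1)
    {e e₂ : Fin (k + 2) → ℂ} {F : Fin (k + 2) × Plu k → ℂ} (ha : e a ≠ 0) (hb : e₂ b ≠ 0)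
    {G : Fin (k + 1) × Fin (k + 1) → ℂ}
    (hF : ∀ w, (∃ j, w j = e) → apply F (extensor w) = 0)
    (he₂ : ∀ s : Plu k, ∑ i, F (i, s) * e₂ i = 0)
    (hFG : ∀ w, e₂ b • apply F (extensor w) = (orthogonalMatrix b e₂ G).mulVec
        fun i => ε i * join e w (a.succAbove i) / e a)
    {c : ℂ} (hc : c ≠ 0) (h : linSubst (orthogonalMatrix b e₂ G) φ₂
      = C c * linSubst (hyperplaneMatrix a ε e) φ₁) : IsSolution φ₁ φ₂ e F e₂ := by
  refine ⟨hF, ⟨c / e₂ b ^ d₂, div_ne_zero hc (pow_ne_zero _ hb), fun w => ?_⟩, he₂⟩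
  have h1 := congrArg (eval fun i => ε i * join e w (a.succAbove i) / e a) h
  rw [map_mul, eval_C, eval_linSubst, eval_linSubst, ← hFG,
    hyperplaneMatrix_mulVec_eq hε ha (dotProduct_join_self e w),
    eval_smul_of_isHomogeneous h₂] at h1
  have : e₂ b ^ d₂ ≠ 0 := pow_ne_zero _ hb
  field_simp
  linear_combination h1

theorem IsHypersurfaceWith.eval_zero {ι : Type} {Z : Set (PSpace ι)} {φ : MvPolynomial ι ℂ}
    (h : IsHypersurfaceWith Z φ) : eval 0 φ = 0 := by
  obtain ⟨v, hv⟩ := cone_nonempty_of_ideal_ne_top h.ideal_ne_top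
  have hφ : eval v φ = 0 := mem_ideal.mp
    (by rw [h.2.2]; exact Ideal.mem_span_singleton_self φ) v hv
  rw [← zero_smul ℂ v, eval_smul_of_isHomogeneous h.isHomogeneous, hφ, mul_zero]

/-- The parameter count. In the chart, the Kruppa equation says that two forms of degree `d` in
`k + 1` variables are proportional; near a solution this amounts to one equation for each monomial
of degree `d` except one. -/
theorem le_affineDim_cone₃_solutionVariety (hk : k ≠ 0) {d₁ d₂ : ℕ} (h₁ : φ₁.IsHomogeneous d₁)
    (h₂ : φ₂.IsHomogeneous d₂) (h₀ : eval 0 φ₂ = 0)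
    (hφ₁ : ∀ e : Fin (k + 2) → ℂ, e ≠ 0 → ∃ y, e ⬝ᵥ y = 0 ∧ eval y φ₁ ≠ 0)
    (hV : (solutionVariety φ₁ φ₂).Nonempty) :
    ((k + 2) + (k + 2) + (k + 1) * (k + 1) + 1 : ℤ) - (k + d₁).choose d₁
      ≤ affineDim (cone₃ (solutionVariety φ₁ φ₂)) := by
  obtain ⟨⟨p₁, p₂, p₃⟩, hp⟩ := hV
  change IsSolution φ₁ φ₂ p₁.rep p₂.rep p₃.rep at hp
  have hne : (cone₃ (solutionVariety φ₁ φ₂)).Nonempty :=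
    ⟨_, mem_cone₃_solutionVariety h₁ h₂ p₁.rep_nonzero p₂.rep_nonzero p₃.rep_nonzero hp⟩
  obtain ⟨a, ha⟩ := Function.ne_iff.mp p₁.rep_nonzero
  obtain ⟨b, hb⟩ := Function.ne_iff.mp p₃.rep_nonzero
  rw [Pi.zero_apply] at ha hb
  obtain ⟨ε, hε, hεj⟩ := exists_sign (k := k) a
  obtain ⟨c, hc, hpc⟩ := linSubst_eq_of_isSolution hk h₂ hε hεj ha hb hp
  -- the form on the right-hand side is not zero, because some hyperplane through the first point
  -- does not lie on the first dual hypersurface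
  obtain ⟨α, hα⟩ : ∃ α, coeff α (linSubst (hyperplaneMatrix a ε p₁.rep) φ₁) ≠ 0 := by
    obtain ⟨y, hy, hyφ⟩ := hφ₁ _ p₁.rep_nonzero
    by_contra! hcon
    apply hyφ
    have h : linSubst (hyperplaneMatrix a ε p₁.rep) φ₁ = 0 := by
      ext α
      rw [hcon α, coeff_zero]
    rw [← hyperplaneMatrix_mulVec_eq hε ha hy, ← eval_linSubst, h, map_zero]
  have hα₂ : coeff α (linSubst (orthogonalMatrix b p₃.rep
      fun x => p₂.rep (b.succAbove x.1, omitTwo a x.2)) φ₂) ≠ 0 := by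
    rw [hpc, coeff_C_mul]
    exact mul_ne_zero hc hα
  obtain rfl : d₁ = d₂ := by
    by_contra hd
    rcases eq_or_ne α.degree d₁ with h | h
    · exact hα₂ ((isHomogeneous_linSubst _ h₂).coeff_eq_zero (h ▸ hd))
    · exact hα ((isHomogeneous_linSubst _ h₁).coeff_eq_zero h)
  let E := (Finset.univ : Finset (Fin (k + 1))).finsuppAntidiag d₁
  have hαE : α ∈ E := by
    refine Finset.mem_finsuppAntidiag.mpr ⟨?_, Finset.subset_univ _⟩
    rw [← Finsupp.degree_eq_sum]
    by_contra h
    exact hα ((isHomogeneous_linSubst _ h₁).coeff_eq_zero h)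
  let P := fun β => coeff β (leftForm b φ₂)
  let Q := fun β => coeff β (rightForm a ε φ₁)
  obtain ⟨d, g, hd, hg⟩ := exists_indepOn_zeros (σ := ChartParam k) (E := E.erase α)
    (fun β => P β * Q α - P α * Q β)
    (X (Sum.inl a) * X (Sum.inr (Sum.inl b)) * P α * Q α)
    (Sum.elim p₁.rep (Sum.elim p₃.rep fun x => p₂.rep (b.succAbove x.1, omitTwo a x.2)))
    (by
      intro β
      simp only [P, Q, map_sub, map_mul, eval_coeff_leftForm, eval_coeff_rightForm,
        Sum.elim_inl, Sum.elim_inr, hpc, coeff_C_mul]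
      ring)
    (by
      simp only [P, Q, map_mul, eval_coeff_leftForm, eval_coeff_rightForm, eval_X,
        Sum.elim_inl, Sum.elim_inr]
      exact mul_ne_zero (mul_ne_zero (mul_ne_zero ha hb) hα₂) hα)
  -- the zero set of the equations is the image of a part of the multi-cone under a projection
  have hg' := hg.pullback (A := cone₃ (solutionVariety φ₁ φ₂))
    (Sum.elim (fun i => X (Sum.inl i)) (Sum.elim (fun i => X (Sum.inr (Sum.inr i)))
      fun x => X (Sum.inr (Sum.inl (b.succAbove x.1, omitTwo a x.2))))) (by
    rintro x ⟨hx, hΔ⟩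
    let e : Fin (k + 2) → ℂ := fun i => x (Sum.inl i)
    let e₂ : Fin (k + 2) → ℂ := fun i => x (Sum.inr (Sum.inl i))
    let G : Fin (k + 1) × Fin (k + 1) → ℂ := fun i => x (Sum.inr (Sum.inr i))
    simp only [P, Q, map_mul, eval_coeff_leftForm, eval_coeff_rightForm, eval_X, mul_ne_zero_iff]
      at hΔ
    obtain ⟨⟨⟨ha', hb'⟩, hPα⟩, hQα⟩ := hΔ
    have hprop := eq_C_mul_of_coeff_mul_eq
      (isHomogeneous_linSubst (orthogonalMatrix b e₂ G) h₂)
      (isHomogeneous_linSubst (hyperplaneMatrix a ε e) h₁) hQα (by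
        intro β hβ hβα
        have h := hx ⟨β, Finset.mem_erase.mpr ⟨hβα, hβ⟩⟩
        simpa only [P, Q, map_sub, map_mul, eval_coeff_leftForm, eval_coeff_rightForm] using h)
    have hc' := div_ne_zero hPα hQα
    obtain ⟨F, hF, hFe₂, hFG, hFw⟩ := exists_matrix_of_chart hε hεj (e := e) (e₂ := e₂) ha' hb' G
    have hsol := isSolution_of_linSubst_eq h₂ hε (e := e) (e₂ := e₂) ha' hb' hF hFe₂ hFw hc' hprop
    have hF0 : F ≠ 0 := by
      rintro rfl
      apply hPα
      have h3 : G = 0 := funext fun i => (hFG i).symm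
      have h4 : orthogonalMatrix b e₂ G = 0 := by
        rw [h3]
        ext j i
        refine Fin.succAboveCases b ?_ (fun l => ?_) j <;> simp [orthogonalMatrix]
      have h5 : linSubst (orthogonalMatrix b e₂ G) φ₂ = 0 := by
        apply MvPolynomial.funext
        intro z
        rw [eval_linSubst, h4, Matrix.zero_mulVec, h₀, map_zero]
      change coeff α (linSubst (orthogonalMatrix b e₂ G) φ₂) = 0
      rw [h5, coeff_zero]
    refine ⟨_, mem_cone₃_solutionVariety h₁ h₂ (fun hc => ha' (congrFun hc a)) hF0
      (fun hc => hb' (congrFun hc b)) hsol, ?_⟩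
    ext (i | i | i)
    · simp [e]
    · simp [e₂]
    · simpa using hFG i)
  have h := le_affineDim hne hg'
  have hE : Nat.card (E.erase α) + 1 = (k + d₁).choose d₁ := by
    rw [Nat.card_eq_fintype_card, Fintype.card_coe, Finset.card_erase_add_one hαE,
      card_finsuppAntidiag_fin]
  have hP : Nat.card (ChartParam k) = (k + 2) + ((k + 2) + (k + 1) * (k + 1)) := by
    simp [ChartParam]
  rw [hP] at hd
  rw [← hE]
  push_cast
  zify at hd
  linarith

end Chart

end GenKruppa

end

theorem mainTheorem9 (k n : ℕ) (hn : n ≤ k)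
    -- with `m = k + 2`: a smooth irreducible variety of dimension `n ≤ m - 2` in `ℙ^m`
    (X : Set (GenKruppa.PSpace (Fin (k + 3))))
    (hX : GenKruppa.IsSmoothVariety X n) (hnd : GenKruppa.Nondegenerate X)
    -- the dual variety of `X` is a hypersurface with polynomial `ψ`, whose degree is the class
    (ψ : MvPolynomial (Fin (k + 3)) ℂ)
    (hψ : GenKruppa.IsHypersurfaceWith (GenKruppa.dualVariety X) ψ)
    -- two projections whose centres are distinct and do not lie on `X`
    (M₁ M₂ : Matrix (Fin (k + 2)) (Fin (k + 3)) ℂ)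
    (hM : GenKruppa.IsProjectionPair M₁ M₂)
    (hO₁ : ∀ v ∈ GenKruppa.cone X, M₁.mulVec v ≠ 0)
    (hO₂ : ∀ v ∈ GenKruppa.cone X, M₂.mulVec v ≠ 0)
    -- the dual varieties of the projections of `X` are hypersurfaces, with polynomials `φ₁, φ₂`
    (φ₁ φ₂ : MvPolynomial (Fin (k + 2)) ℂ)
    (hφ₁ : GenKruppa.IsHypersurfaceWith
      (GenKruppa.dualVariety (GenKruppa.projection M₁ X)) φ₁)
    (hφ₂ : GenKruppa.IsHypersurfaceWith
      (GenKruppa.dualVariety (GenKruppa.projection M₂ X)) φ₂)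
    (hV : (GenKruppa.solutionVariety φ₁ φ₂).Nonempty) :
    (GenKruppa.projDim (GenKruppa.fundamentalMatrices k)
        - (Nat.choose (k + ψ.totalDegree) ψ.totalDegree : ℤ) + 1
      ≤ GenKruppa.projDim₃ (GenKruppa.solutionVariety φ₁ φ₂)) ∧
    ((GenKruppa.solutionVariety φ₁ φ₂).Finite →
      GenKruppa.projDim (GenKruppa.fundamentalMatrices k) + 1
        ≤ (Nat.choose (k + ψ.totalDegree) ψ.totalDegree : ℤ)) := by
  have hk := GenKruppa.ne_zero_of_projection hX.irreducible hnd hM.1 hO₁ hφ₁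
  have h1 := GenKruppa.le_affineDim_cone₃_solutionVariety hk hφ₁.isHomogeneous hφ₂.isHomogeneous
    hφ₂.eval_zero (fun e he => GenKruppa.exists_eval_ne_zero_of_projection hX.irreducible hnd hM.1
      hO₁ hφ₁ he) hV
  have h2 := GenKruppa.projDim_fundamentalMatrices_le hk
  have h3 : (k + φ₁.totalDegree).choose φ₁.totalDegree
      ≤ (k + ψ.totalDegree).choose ψ.totalDegree := by
    rw [Nat.choose_symm_add.symm, Nat.choose_symm_add.symm]
    exact Nat.choose_le_choose k (Nat.add_le_add_left
      (GenKruppa.totalDegree_le_of_projection hX hM.1 hO₁ hψ hφ₁) k)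
  zify at h3
  have h4 : GenKruppa.projDim (GenKruppa.fundamentalMatrices k)
        - (Nat.choose (k + ψ.totalDegree) ψ.totalDegree : ℤ) + 1
      ≤ GenKruppa.projDim₃ (GenKruppa.solutionVariety φ₁ φ₂) := by
    rw [GenKruppa.projDim₃]
    linarith
  refine ⟨h4, fun hfin => ?_⟩
  have h5 := GenKruppa.projDim₃_le_zero_of_finite hfin
  linarith
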